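/- Let $L>0$, $I=(0,L)$, and let $H^2(I)$ be the usual Sobolev space. For $\tau\ge 0$ let $X_\tau=L^\infty(-\infty,\tau;H^2(I))$, with norm $\|z\|_{X_\tau}=\operatorname{ess\,sup}_{t<\tau}\|z(t)\|_{H^2(I)}$. Let $\rho$ be a kernel with $$0\le\rho\in L^\infty(0,\infty;H^2(I))\cap L^1(0,\infty;H^2(I)),\qquad \mu(s):=\int_0^\infty\rho(s,a)\,da\ \ge\ \mu_{\min}>0\quad (s\in I),$$ for some constant $\mu_{\min}$. Let $F(\xi)=(\xi^2-1)^2$. For $\varepsilon>0$ and $f,g\in L^2(I)$ let $A_\varepsilon(f,g)$ be the unique $u\in H^2(I)$ such that $$\int_I \mu uv\,ds+\varepsilon\int_I u''v''\,ds=-\varepsilon\int_I f v'\,ds+\int_I gv\,ds\qquad\text{for all }v\in H^2(I),$$ and put $A_{1,\varepsilon}f=A_\varepsilon(f,0)$, $A_{2,\varepsilon}g=A_\varepsilon(0,g)$. Given past data $z_p\in X_0$ and $\tau>0$, a solution on $(0,\tau)$ is a function $z\in X_\tau$ such that $$z(t)=A_{1,\varepsilon}F'(z'(t))+A_{2,\varepsilon}\int_0^\infty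 z(t-\varepsilon a)\,\rho(\cdot,a)\,da\ \text{ for a.e. }t\in(0,\tau),\qquad z(t)=z_p(t)\ \text{ for a.e. }t<0,\tag{P}$$ where $'$ denotes the derivative in $s\in I$. Theorem 4.1. There are constants $c_1,\dots,c_5>0$ with $c_2<1$, depending only on $\rho$ and $L$, such that for every $z_p\in X_0$, with $$R_0:=1+c_1\|z_p\|_{X_0},\qquad \varepsilon_1:=c_2R_0^{-8},$$ the following holds for every $\varepsilon\in(0,\varepsilon_1]$. (i) For $T=c_3\varepsilon$ there is exactly one solution $z\in X_T$ of (P) on $(0,T)$ with $\|z\|_{X_T}\le R_0$. (ii) For every $\tau>0$ there is at most one solution $z\in X_\tau$ of (P) on $(0,\tau)$ with $\|z\|_{X_\tau}\le c_4\varepsilon^{-1/8}$. (iii) Let $z$ be the local solution from (i), and let $T^*$ be the supremum of all $\tau>0$ such that $z$ extends (or, if $\tau<c_3\varepsilon$, restricts) to a solution $w\in X_\tau$ of (P) on $(0,\tau)$ with $\|w\|_{X_\tau}\le c_4\varepsilon^{-1/8}$. The time $\tau=c_3\varepsilon$ is among these, so $T^*\ge c_3\varepsilon$. If $T^*<\infty$,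 then $z$ extends to a solution in $X_{T^*}$ of (P) on $(0,T^*)$, still denoted $z$, with $$c_5\varepsilon^{-1/8}\le\|z\|_{X_{T^*}}\le c_4\varepsilon^{-1/8}.$$ -/

import Mathlib

open MeasureTheory Set
open scoped ENNReal ContDiff

noncomputable section

namespace DelayedFilament

/-- Lebesgue measure on the interval `I = (0, L)`. -/
abbrev volI (L : ℝ) : Measure ℝ := volume.restrict (Ioo 0 L)

/-- The space `L²(I)`. -/
abbrev L2 (L : ℝ) : Type := Lp ℝ 2 (volI L)

/-- `g` is the weak derivative of `f` on `I`, tested against smooth functions with compact support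
in `I`. -/
def HasWeakDeriv (L : ℝ) (f g : L2 L) : Prop :=
  ∀ φ : ℝ → ℝ, ContDiff ℝ ∞ φ → HasCompactSupport φ → tsupport φ ⊆ Ioo 0 L →
    ∫ s in Ioo 0 L, f s * deriv φ s = -∫ s in Ioo 0 L, g s * φ s

theorem integrable_mul_test {L : ℝ} (f : L2 L) {φ : ℝ → ℝ} (hc : Continuous φ)
    (hs : HasCompactSupport φ) : Integrable (fun s => f s * φ s) (volI L) := by
  have h1 : MemLp φ 2 (volI L) := (hc.memLp_of_hasCompactSupport hs).restrict _
  exact (Lp.memLp f).integrable_mul h1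

theorem HasWeakDeriv.zero (L : ℝ) : HasWeakDeriv L 0 0 := by
  intro φ _ _ _
  have h0 : ∀ ψ : ℝ → ℝ, ∫ s in Ioo 0 L, (0 : L2 L) s * ψ s = 0 := by
    intro ψ
    rw [integral_congr_ae (g := fun _ => (0 : ℝ)), integral_zero]
    filter_upwards [Lp.coeFn_zero ℝ 2 (volI L)] with s hs
    rw [hs, Pi.zero_apply, zero_mul]
  rw [h0, h0, neg_zero]

theorem HasWeakDeriv.add {L : ℝ} {f₁ g₁ f₂ g₂ : L2 L} (h₁ : HasWeakDeriv L f₁ g₁)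
    (h₂ : HasWeakDeriv L f₂ g₂) : HasWeakDeriv L (f₁ + f₂) (g₁ + g₂) := by
  intro φ hφ hs ht
  have key : ∀ (p q : L2 L) (ψ : ℝ → ℝ), Continuous ψ → HasCompactSupport ψ →
      ∫ s in Ioo 0 L, (p + q : L2 L) s * ψ s
        = (∫ s in Ioo 0 L, p s * ψ s) + ∫ s in Ioo 0 L, q s * ψ s := by
    intro p q ψ hc hψ
    rw [← integral_add (integrable_mul_test p hc hψ) (integrable_mul_test q hc hψ)]
    apply integral_congr_ae
    filter_upwards [Lp.coeFn_add p q] with s hs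
    rw [hs, Pi.add_apply, add_mul]
  rw [key _ _ _ (hφ.continuous_deriv (by simp)) hs.deriv, key _ _ _ hφ.continuous hs,
    h₁ φ hφ hs ht, h₂ φ hφ hs ht]
  ring

theorem HasWeakDeriv.smul {L : ℝ} {f g : L2 L} (c : ℝ) (h : HasWeakDeriv L f g) :
    HasWeakDeriv L (c • f) (c • g) := by
  intro φ hφ hs ht
  have key : ∀ (p : L2 L) (ψ : ℝ → ℝ),
      ∫ s in Ioo 0 L, (c • p : L2 L) s * ψ s = c * ∫ s in Ioo 0 L, p s * ψ s := by
    intro p ψ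
    rw [← integral_const_mul]
    apply integral_congr_ae
    filter_upwards [Lp.coeFn_smul c p] with s hs
    rw [hs, Pi.smul_apply, smul_eq_mul, mul_assoc]
  rw [key, key, h φ hφ hs ht]
  ring

/-- The Sobolev space `H²(I)`: triples `(u, u', u'')` of `L²(I)` functions such that `u'` is the weak
derivative of `u` and `u''` is the weak derivative of `u'`, with the Hilbert norm
`(‖u‖₂² + ‖u'‖₂² + ‖u''‖₂²)^(1/2)`. -/
def H2 (L : ℝ) : Submodule ℝ (PiLp 2 (fun _ : Fin 3 => L2 L)) where
  carrier := {u | HasWeakDeriv L (u 0) (u 1) ∧ HasWeakDeriv L (u 1) (u 2)}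
  zero_mem' := ⟨HasWeakDeriv.zero L, HasWeakDeriv.zero L⟩
  add_mem' := fun h h' => ⟨h.1.add h'.1, h.2.add h'.2⟩
  smul_mem' := fun c _ h => ⟨h.1.smul c, h.2.smul c⟩

/-- The `j`-th (weak) derivative of `u ∈ H²(I)`, `j = 0, 1, 2`. -/
def D {L : ℝ} (j : Fin 3) (u : H2 L) : L2 L := (u : PiLp 2 (fun _ : Fin 3 => L2 L)) j

/-- The space `X_τ = L^∞(-∞, τ; H²(I))` (Bochner measurable, essentially bounded functions modulo
equality almost everywhere), with the essential supremum norm. -/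
abbrev X (L τ : ℝ) : Type := Lp (H2 L) ∞ (volume.restrict (Iio τ))

/-- The double-well potential. -/
def F (ξ : ℝ) : ℝ := (ξ ^ 2 - 1) ^ 2

/-- `μ(s) = ∫₀^∞ ρ(s, a) da`, as an `L²(I)`-valued integral. -/
def mu {L : ℝ} (ρ : ℝ → H2 L) : L2 L := ∫ a in Ioi (0 : ℝ), D 0 (ρ a)

/-- The assumptions on the kernel: `0 ≤ ρ ∈ L^∞(0, ∞; H²(I)) ∩ L¹(0, ∞; H²(I))`, and
`μ(s) ≥ μ_min > 0` on `I`. -/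
structure IsKernel {L : ℝ} (ρ : ℝ → H2 L) : Prop where
  nonneg : ∀ᵐ a ∂(volume.restrict (Ioi (0 : ℝ))), ∀ᵐ s ∂(volI L), 0 ≤ D 0 (ρ a) s
  memLp_top : MemLp ρ ∞ (volume.restrict (Ioi (0 : ℝ)))
  memLp_one : MemLp ρ 1 (volume.restrict (Ioi (0 : ℝ)))
  mu_pos : ∃ μmin : ℝ, 0 < μmin ∧ ∀ᵐ s ∂(volI L), μmin ≤ mu ρ s

/-- `u ∈ H²(I)` is a weak solution of `k u + ε u'''' = ε f' + g` in `I`, `u'' = 0` and `u''' = f` on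
the boundary of `I`. -/
def IsWeakSolution {L : ℝ} (ε : ℝ) (k f g : ℝ → ℝ) (u : H2 L) : Prop :=
  ∀ v : H2 L,
    (∫ s in Ioo 0 L, k s * D 0 u s * D 0 v s) + ε * (∫ s in Ioo 0 L, D 2 u s * D 2 v s)
      = -ε * (∫ s in Ioo 0 L, f s * D 1 v s) + ∫ s in Ioo 0 L, g s * D 0 v s

open Classical in
/-- The resolvent operator `A_ε(f, g)`: the weak solution `u` of the linear problem with data
`(f, g)`. (It exists and is unique for `ε > 0`, `f, g ∈ L²(I)` and `k` bounded between two positive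
constants; the value `0` is used otherwise.) -/
def A (L ε : ℝ) (k f g : ℝ → ℝ) : H2 L :=
  if h : ∃! u : H2 L, IsWeakSolution ε k f g u then h.choose else 0

/-- `A_{1,ε} f = A_ε(f, 0)`. -/
def A₁ (L ε : ℝ) (k f : ℝ → ℝ) : H2 L := A L ε k f 0

/-- `A_{2,ε} g = A_ε(0, g)`. -/
def A₂ (L ε : ℝ) (k g : ℝ → ℝ) : H2 L := A L ε k 0 g

/-- The memory term `∫₀^∞ z(·, t - ε a) ρ(·, a) da`. The integrand is the product of two `L²(I)`
functions, and the integral is taken in `L¹(I)`. -/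
def memory {L : ℝ} (ε : ℝ) (ρ z : ℝ → H2 L) (t : ℝ) : Lp ℝ 1 (volI L) :=
  ∫ a in Ioi (0 : ℝ), (D 0 (z (t - ε * a)) • D 0 (ρ a) : Lp ℝ 1 (volI L))

/-- `z ∈ X_τ` solves the fixed-point form of the delayed problem on `(0, τ)`, with past data `zp`. -/
structure IsSolution {L : ℝ} (ε : ℝ) (ρ : ℝ → H2 L) (zp : X L 0) (τ : ℝ) (z : X L τ) : Prop where
  eqn : ∀ᵐ t ∂(volume.restrict (Ioo 0 τ)),
    z t = A₁ L ε (mu ρ) (fun s => deriv F (D 1 (z t) s)) + A₂ L ε (mu ρ) (memory ε ρ z t)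
  past : ∀ᵐ t ∂(volume.restrict (Iio (0 : ℝ))), z t = zp t

/-- Two elements `z ∈ X_σ` and `w ∈ X_τ` coincide on their common time interval: the one with the
larger interval extends the other. -/
def Agree {L σ τ : ℝ} (z : X L σ) (w : X L τ) : Prop :=
  ∀ᵐ t ∂(volume.restrict (Iio (min σ τ))), w t = z t

/-- The set of all `τ > 0` such that `z` extends to a solution `w ∈ X_τ` with `‖w‖ ≤ M`. -/
def extensionTimes {L σ : ℝ} (ε : ℝ) (ρ : ℝ → H2 L) (zp : X L 0) (M : ℝ) (z : X L σ) : Set ℝ :=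
  {τ | 0 < τ ∧ ∃ w : X L τ, IsSolution ε ρ zp τ w ∧ Agree z w ∧ ‖w‖ ≤ M}

end DelayedFilament

end

open Filter Topology
open scoped NNReal

noncomputable section

namespace DelayedFilament

/-! The problem is a fixed-point equation in `H2`: `z` equals `N z` plus a memory term, where `N u`
is A₁ applied to F'(u') and the memory term is A₂ of the delayed average. Two resolvent estimates
carry the proof. (1) Testing the equation with u and interpolating u' between u and u'' at the scale
η = ε^(1/4) shows that A₁ : L² → H² has norm O(ε^(1/4)) (`exists_bound_A₁`). Since F' is cubic and
H² embeds into C¹, `N` has Lipschitz constant O(ε^(1/4) (1 + R²)) on the ball of radius R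
(`exists_nonlin_lipschitz`). This is small as long as ε is small and R stays below a small multiple
of ε^(-1/8), which is where the exponent 1/8 comes from. (2) A₂ is bounded on H² uniformly in ε ≤ 1
(`exists_A₂L`), because A₂ G differs from G/μ, itself in H², by an error that the energy controls.

On a time step of length h = c₃ ε the unknown part of z enters the memory only through delays a ≤
c₃. As ρ is bounded, this part is a contraction with factor 1/4 (`norm_delay_sub_le`); `N`
contributes another 1/4. Banach's theorem continues any history that is small compared with R over
one step (`exists_extension`), and the same estimate, iterated over steps, gives uniqueness
(`unique`). The step length is the same for all admissible R. Solutions bounded by c₄ ε^(-1/8)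
therefore glue to one on the maximal interval, and if its norm were below c₅ ε^(-1/8), one further
step would pass the maximal time (`exists_maximal`). -/

/-- `f` is absolutely continuous on `[0, L]`, with almost everywhere derivative `g`. -/
structure IsPrimitive (L : ℝ) (f g : ℝ → ℝ) : Prop where
  ac : AbsolutelyContinuousOnInterval f 0 L
  hasDerivAt : ∀ᵐ x, x ∈ uIcc 0 L → HasDerivAt f (g x) x

/-! ### Calculus of absolutely continuous functions on [0, L]. -/

namespace IsPrimitive

variable {L : ℝ} {f g f₁ g₁ f₂ g₂ : ℝ → ℝ}

theorem deriv_ae (h : IsPrimitive L f g) : ∀ᵐ x, x ∈ uIcc 0 L → deriv f x = g x := by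
  filter_upwards [h.hasDerivAt] with x hx hxL using (hx hxL).deriv

theorem deriv_ae_uIoc (h : IsPrimitive L f g) :
    deriv f =ᵐ[volume.restrict (uIoc 0 L)] g := by
  rw [Filter.EventuallyEq, ae_restrict_iff' measurableSet_uIoc]
  filter_upwards [h.deriv_ae] with x hx hxL using hx (uIoc_subset_uIcc hxL)

theorem intervalIntegrable (h : IsPrimitive L f g) : IntervalIntegrable g volume 0 L :=
  h.ac.intervalIntegrable_deriv.congr_ae h.deriv_ae_uIoc

theorem of_intervalIntegrable (hg : IntervalIntegrable g volume 0 L) (c : ℝ) :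
    IsPrimitive L (fun x => c + ∫ t in (0 : ℝ)..x, g t) g where
  ac := by
    have h1 : AbsolutelyContinuousOnInterval (fun _ : ℝ => c) 0 L :=
      (LipschitzWith.const c).lipschitzOnWith.absolutelyContinuousOnInterval
    exact h1.fun_add (hg.absolutelyContinuousOnInterval_intervalIntegral (by simp))
  hasDerivAt := by
    filter_upwards [hg.ae_hasDerivAt_integral] with x hx hxL
    exact (hx hxL 0 (by simp)).const_add c

theorem mul (h₁ : IsPrimitive L f₁ g₁) (h₂ : IsPrimitive L f₂ g₂) :
    IsPrimitive L (fun x => f₁ x * f₂ x) (fun x => g₁ x * f₂ x + f₁ x * g₂ x) where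
  ac := h₁.ac.fun_mul h₂.ac
  hasDerivAt := by
    filter_upwards [h₁.hasDerivAt, h₂.hasDerivAt] with x hx hx' hxL
    exact (hx hxL).mul (hx' hxL)

theorem add (h₁ : IsPrimitive L f₁ g₁) (h₂ : IsPrimitive L f₂ g₂) :
    IsPrimitive L (fun x => f₁ x + f₂ x) (fun x => g₁ x + g₂ x) where
  ac := h₁.ac.fun_add h₂.ac
  hasDerivAt := by
    filter_upwards [h₁.hasDerivAt, h₂.hasDerivAt] with x hx hx' hxL
    exact (hx hxL).add (hx' hxL)

theorem neg (h : IsPrimitive L f g) : IsPrimitive L (fun x => -f x) (fun x => -g x) where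
  ac := h.ac.neg
  hasDerivAt := by
    filter_upwards [h.hasDerivAt] with x hx hxL
    exact (hx hxL).neg

theorem congr_right (h : IsPrimitive L f g) (hg : ∀ᵐ x, x ∈ uIcc 0 L → g x = g₁ x) :
    IsPrimitive L f g₁ where
  ac := h.ac
  hasDerivAt := by
    filter_upwards [h.hasDerivAt, hg] with x hx hx' hxL
    exact hx' hxL ▸ hx hxL

/-- The map y ↦ 1/y is Lipschitz on [m, ∞) with constant m⁻², so the increments of 1/f over disjoint
intervals are dominated by those of m⁻² f. -/
theorem inv {m : ℝ} (h : IsPrimitive L f g) (hm : 0 < m) (hf : ∀ x ∈ uIcc 0 L, m ≤ f x) :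
    IsPrimitive L (fun x => (f x)⁻¹) (fun x => -g x * ((f x)⁻¹ * (f x)⁻¹)) where
  ac := by
    have key : ∀ x ∈ uIcc 0 L, ∀ y ∈ uIcc 0 L,
        dist (f x)⁻¹ (f y)⁻¹ ≤ (m * m)⁻¹ * dist (f x) (f y) := by
      intro x hx y hy
      have h1 := hf x hx
      have h2 := hf y hy
      have h3 : (f x)⁻¹ - (f y)⁻¹ = (f x * f y)⁻¹ * (f y - f x) := by
        have := hm.trans_le h1
        have := hm.trans_le h2
        field_simp
      rw [Real.dist_eq, h3, abs_mul, Real.dist_eq, abs_sub_comm (f y),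
        abs_of_pos (inv_pos.2 (mul_pos (hm.trans_le h1) (hm.trans_le h2)))]
      have h4 : 0 ≤ f x := hm.le.trans h1
      gcongr
    have h0 := (h.ac.const_mul (m * m)⁻¹)
    unfold AbsolutelyContinuousOnInterval at h0 ⊢
    refine squeeze_zero' ?_ ?_ h0
    · filter_upwards with I using Finset.sum_nonneg fun _ _ => dist_nonneg
    · have : ∀ᶠ (E : ℕ × (ℕ → ℝ × ℝ)) in AbsolutelyContinuousOnInterval.totalLengthFilter ⊓
          𝓟 (AbsolutelyContinuousOnInterval.disjWithin 0 L),
          E ∈ AbsolutelyContinuousOnInterval.disjWithin 0 L :=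
        eventually_inf_principal.mpr (by simp)
      filter_upwards [this] with E hE
      refine Finset.sum_le_sum fun i hi => ?_
      have hE' := hE.1 i hi
      refine (key _ hE'.1 _ hE'.2).trans_eq ?_
      simp only [Real.dist_eq, ← mul_sub, abs_mul]
      rw [abs_of_pos (inv_pos.2 (mul_pos hm hm))]
  hasDerivAt := by
    filter_upwards [h.hasDerivAt] with x hx hxL
    have h1 : f x ≠ 0 := (hm.trans_le (hf x hxL)).ne'
    convert! (hx hxL).inv h1 using 1
    field_simp

theorem integral_eq_sub {a b : ℝ} (h : IsPrimitive L f g) (ha : a ∈ uIcc 0 L) (hb : b ∈ uIcc 0 L) :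
    ∫ x in a..b, g x = f b - f a := by
  have hs : uIcc a b ⊆ uIcc 0 L := uIcc_subset_uIcc ha hb
  rw [← (h.ac.mono hs).integral_deriv_eq_sub]
  apply intervalIntegral.integral_congr_ae
  filter_upwards [h.deriv_ae] with x hx hxL
  exact (hx (hs (uIoc_subset_uIcc hxL))).symm

theorem continuousOn (h : IsPrimitive L f g) : ContinuousOn f (uIcc 0 L) := h.ac.continuousOn

theorem of_contDiff {φ : ℝ → ℝ} (hφ : ContDiff ℝ 1 φ) : IsPrimitive L φ (deriv φ) where
  ac := hφ.contDiffOn.absolutelyContinuousOnInterval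
  hasDerivAt := by
    filter_upwards with x _
    exact (hφ.differentiable (by norm_num) x).hasDerivAt

/-- The boundary terms are kept: elements of `H2` satisfy no boundary conditions, and the
interpolation inequality has to estimate these terms. -/
theorem integral_mul {f₁ g₁ f₂ g₂ : ℝ → ℝ} (hL : 0 ≤ L) (h₁ : IsPrimitive L f₁ g₁)
    (h₂ : IsPrimitive L f₂ g₂) :
    ∫ s in Ioo 0 L, f₁ s * g₂ s
      = f₁ L * f₂ L - f₁ 0 * f₂ 0 - ∫ s in Ioo 0 L, g₁ s * f₂ s := by
  have h := (h₁.mul h₂).integral_eq_sub (a := 0) (b := L) (by simp) (by simp)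
  have i1 : IntervalIntegrable (fun x => g₁ x * f₂ x) volume 0 L :=
    h₁.intervalIntegrable.mul_continuousOn h₂.continuousOn
  have i2 : IntervalIntegrable (fun x => f₁ x * g₂ x) volume 0 L :=
    h₂.intervalIntegrable.continuousOn_mul h₁.continuousOn
  rw [intervalIntegral.integral_add i1 i2] at h
  rw [← integral_Ioc_eq_integral_Ioo, ← integral_Ioc_eq_integral_Ioo,
    ← intervalIntegral.integral_of_le hL, ← intervalIntegral.integral_of_le hL]
  linarith

end IsPrimitive

/-! ### Absolutely continuous representatives of weakly differentiable functions. -/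

theorem integrable_L2 {L : ℝ} (f : L2 L) : Integrable f (volI L) :=
  (Lp.memLp f).integrable (by norm_num)

theorem intervalIntegrable_L2 {L : ℝ} (hL : 0 ≤ L) (f : L2 L) :
    IntervalIntegrable f volume 0 L := by
  rw [intervalIntegrable_iff_integrableOn_Ioo_of_le hL]
  exact integrable_L2 f

theorem test_boundary {L : ℝ} {φ : ℝ → ℝ} (ht : tsupport φ ⊆ Ioo 0 L) : φ 0 = 0 ∧ φ L = 0 := by
  constructor <;> refine image_eq_zero_of_notMem_tsupport fun h => ?_
  · exact lt_irrefl _ (ht h).1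
  · exact lt_irrefl _ (ht h).2

theorem IsPrimitive.integral_mul_test {L : ℝ} (hL : 0 ≤ L) {f g : ℝ → ℝ} (h : IsPrimitive L f g)
    {φ : ℝ → ℝ} (hφ : ContDiff ℝ ∞ φ) (ht : tsupport φ ⊆ Ioo 0 L) :
    ∫ s in Ioo 0 L, f s * deriv φ s = -∫ s in Ioo 0 L, g s * φ s := by
  have h2 := h.integral_mul hL (IsPrimitive.of_contDiff (L := L) (hφ.of_le (by exact_mod_cast le_top)))
  rw [(test_boundary ht).1, (test_boundary ht).2] at h2
  rw [h2]; ring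

/-- A compactly supported smooth function in `(0, L)` with zero mean is the derivative of
a compactly supported smooth function in `(0, L)`. -/
theorem exists_test_primitive {L : ℝ} (hL : 0 < L) {θ : ℝ → ℝ} (hθ : ContDiff ℝ ∞ θ)
    (hs : HasCompactSupport θ) (ht : tsupport θ ⊆ Ioo 0 L) (h0 : ∫ s in Ioo 0 L, θ s = 0) :
    ∃ φ : ℝ → ℝ, ContDiff ℝ ∞ φ ∧ HasCompactSupport φ ∧ tsupport φ ⊆ Ioo 0 L ∧
      deriv φ = θ := by
  rcases (tsupport θ).eq_empty_or_nonempty with he | hne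
  · refine ⟨0, contDiff_const, HasCompactSupport.zero, by simp [tsupport], ?_⟩
    have : θ = 0 := by rwa [tsupport_eq_empty_iff] at he
    rw [this]; ext; simp
  obtain ⟨a, ha, ha'⟩ := hs.isCompact.exists_isLeast hne
  obtain ⟨b, hb, hb'⟩ := hs.isCompact.exists_isGreatest hne
  have haI := ht ha
  have hbI := ht hb
  have zl : ∀ s, s < a → θ s = 0 := fun s hsa =>
    image_eq_zero_of_notMem_tsupport fun h => absurd (ha' h) (not_le.2 hsa)
  have zr : ∀ s, b < s → θ s = 0 := fun s hsa =>
    image_eq_zero_of_notMem_tsupport fun h => absurd (hb' h) (not_le.2 hsa)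
  have hc : Continuous θ := hθ.continuous
  have hd : ∀ x, HasDerivAt (fun x => ∫ t in (0 : ℝ)..x, θ t) (θ x) x := fun x =>
    intervalIntegral.integral_hasDerivAt_right (hc.intervalIntegrable _ _)
      (hc.stronglyMeasurableAtFilter _ _) hc.continuousAt
  have hd' : deriv (fun x => ∫ t in (0 : ℝ)..x, θ t) = θ := funext fun x => (hd x).deriv
  have hsupp : Function.support (fun x => ∫ t in (0 : ℝ)..x, θ t) ⊆ Icc a b := by
    intro x hx
    by_contra hcon
    apply hx
    rw [mem_Icc, not_and_or, not_le, not_le] at hcon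
    rcases hcon with h | h
    · apply intervalIntegral.integral_zero_ae
      filter_upwards with t htx
      apply zl
      rcases mem_uIoc.1 htx with h' | h'
      · exact h'.2.trans_lt h
      · exact h'.2.trans_lt haI.1
    -- To the right of the support the primitive equals the total integral, which vanishes by
    -- assumption.
    · have e1 : ∫ t in (0 : ℝ)..L, θ t = 0 := by
        rw [intervalIntegral.integral_of_le hL.le, integral_Ioc_eq_integral_Ioo, h0]
      have e2 : ∫ t in x..L, θ t = 0 := by
        apply intervalIntegral.integral_zero_ae
        filter_upwards with t htx
        apply zr
        rcases mem_uIoc.1 htx with h' | h'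
        · exact h.trans h'.1
        · exact hbI.2.trans h'.1
      have e3 := intervalIntegral.integral_add_adjacent_intervals
        (hc.intervalIntegrable (μ := volume) 0 x) (hc.intervalIntegrable (μ := volume) x L)
      show ∫ t in (0 : ℝ)..x, θ t = 0
      linarith
  have hts : tsupport (fun x => ∫ t in (0 : ℝ)..x, θ t) ⊆ Icc a b :=
    closure_minimal hsupp isClosed_Icc
  refine ⟨fun x => ∫ t in (0 : ℝ)..x, θ t, ?_, ?_, ?_, hd'⟩
  · rw [contDiff_infty_iff_deriv]
    exact ⟨fun x => (hd x).differentiableAt, hd'.symm ▸ hθ⟩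
  · exact HasCompactSupport.of_support_subset_isCompact isCompact_Icc hsupp
  · exact hts.trans fun x hx => ⟨haI.1.trans_le hx.1, hx.2.trans_lt hbI.2⟩

/-- The du Bois-Reymond lemma. -/
theorem ae_eq_const_of_integral_mul_deriv_eq_zero {L : ℝ} (hL : 0 < L) {h : ℝ → ℝ}
    (hi : Integrable h (volI L))
    (h0 : ∀ φ : ℝ → ℝ, ContDiff ℝ ∞ φ → HasCompactSupport φ → tsupport φ ⊆ Ioo 0 L →
      ∫ s in Ioo 0 L, h s * deriv φ s = 0) :
    ∃ c : ℝ, ∀ᵐ s ∂(volI L), h s = c := by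
  -- A reference bump of integral one; the constant sought is the average of `h` against it.
  let B : ContDiffBump (L / 2) := ⟨L / 4, L / 3, by linarith, by linarith⟩
  let ψ₀ : ℝ → ℝ := B.normed volume
  have hψ₀ : ContDiff ℝ ∞ ψ₀ := B.contDiff_normed
  have hψs : HasCompactSupport ψ₀ := B.hasCompactSupport_normed
  have hψt : tsupport ψ₀ ⊆ Ioo 0 L := by
    rw [B.tsupport_normed_eq, Real.closedBall_eq_Icc]
    intro x hx
    have h1 : L / 2 - L / 3 ≤ x := hx.1
    have h2 : x ≤ L / 2 + L / 3 := hx.2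
    exact ⟨by linarith, by linarith⟩
  have hψi : ∫ s in Ioo 0 L, ψ₀ s = 1 := by
    rw [setIntegral_eq_integral_of_forall_compl_eq_zero, B.integral_normed]
    exact fun x hx => image_eq_zero_of_notMem_tsupport fun h => hx (hψt h)
  have hint : ∀ ψ : ℝ → ℝ, Continuous ψ → HasCompactSupport ψ →
      Integrable (fun s => h s * ψ s) (volI L) := by
    intro ψ hc hs
    obtain ⟨C, hC⟩ := hs.exists_bound_of_continuous hc
    exact hi.mul_bdd hc.aestronglyMeasurable (Filter.Eventually.of_forall hC)
  set c := ∫ s in Ioo 0 L, h s * ψ₀ s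
  refine ⟨c, ?_⟩
  have key : ∀ᵐ x, x ∈ Ioo 0 L → h x - c = 0 := by
    apply IsOpen.ae_eq_zero_of_integral_contDiff_smul_eq_zero isOpen_Ioo
    · refine IntegrableOn.locallyIntegrableOn ?_
      exact hi.sub (integrable_const c)
    · intro ψ hψ hs ht
      rw [← setIntegral_eq_integral_of_forall_compl_eq_zero (s := Ioo 0 L)
        (fun x hx => by rw [image_eq_zero_of_notMem_tsupport fun h => hx (ht h), zero_smul])]
      set k := ∫ s in Ioo 0 L, ψ s
      have iψ : Integrable ψ (volI L) :=
        (hψ.continuous.integrable_of_hasCompactSupport hs).restrict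
      have iψ₀ : Integrable ψ₀ (volI L) :=
        (hψ₀.continuous.integrable_of_hasCompactSupport hψs).restrict
      -- Subtracting from `ψ` its mean times the bump leaves a function of zero mean, hence the
      -- derivative of an admissible test function.
      obtain ⟨φ, p1, p2, p3, p4⟩ := exists_test_primitive hL (θ := ψ - k • ψ₀)
        (hψ.sub (hψ₀.const_smul k))
        (hs.sub (hψs.smul_left (f := fun _ => k)))
        ((tsupport_sub _ _).trans (union_subset ht
          ((tsupport_smul_subset_right (fun _ => k) ψ₀).trans hψt)))
        (by
          simp only [Pi.sub_apply, Pi.smul_apply, smul_eq_mul]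
          rw [integral_sub iψ (iψ₀.const_mul k), integral_const_mul, hψi, mul_one, sub_self])
      have h1 := h0 φ p1 p2 p3
      rw [p4] at h1
      have e1 : ∫ s in Ioo 0 L, h s * (ψ - k • ψ₀) s
          = (∫ s in Ioo 0 L, h s * ψ s) - k * c := by
        rw [← integral_const_mul, ← integral_sub (hint ψ hψ.continuous hs)
          ((hint ψ₀ hψ₀.continuous hψs).const_mul k)]
        congr 1; ext s; simp; ring
      have e2 : ∫ s in Ioo 0 L, ψ s • (h s - c) = (∫ s in Ioo 0 L, h s * ψ s) - c * k := by
        rw [← integral_const_mul, ← integral_sub (hint ψ hψ.continuous hs) (iψ.const_mul c)]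
        congr 1; ext s; simp; ring
      rw [e2]; linarith
  rw [ae_restrict_iff' measurableSet_Ioo]
  filter_upwards [key] with x hx hxI
  linarith [hx hxI]

/-- A primitive of `g` has weak derivative `g`, so its difference to `f` has weak derivative zero
and is constant by the du Bois-Reymond lemma. -/
theorem HasWeakDeriv.exists_primitive {L : ℝ} (hL : 0 < L) {f g : L2 L} (h : HasWeakDeriv L f g) :
    ∃ p : ℝ → ℝ, IsPrimitive L p g ∧ f =ᵐ[volI L] p := by
  have hg := intervalIntegrable_L2 hL.le g
  have hp := IsPrimitive.of_intervalIntegrable hg 0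
  set p := fun x => (0 : ℝ) + ∫ t in (0 : ℝ)..x, g t
  have hpc : ContinuousOn p (Icc 0 L) := by simpa [uIcc_of_le hL.le] using hp.continuousOn
  have ip : Integrable p (volI L) :=
    (hpc.integrableOn_compact isCompact_Icc).mono_set Ioo_subset_Icc_self
  obtain ⟨c, hc⟩ := ae_eq_const_of_integral_mul_deriv_eq_zero hL (h := fun s => f s - p s)
    ((integrable_L2 f).sub ip) (by
      intro φ hφ hs ht
      have hc' : Continuous (deriv φ) := hφ.continuous_deriv (by simp)
      obtain ⟨C, hC⟩ := hs.deriv.exists_bound_of_continuous hc'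
      have i1 : Integrable (fun s => p s * deriv φ s) (volI L) :=
        ip.mul_bdd hc'.aestronglyMeasurable (Filter.Eventually.of_forall hC)
      simp only [sub_mul]
      rw [integral_sub (integrable_mul_test f hc' hs.deriv) i1, h φ hφ hs ht,
        hp.integral_mul_test hL.le hφ ht, sub_self])
  refine ⟨_, IsPrimitive.of_intervalIntegrable hg c, ?_⟩
  filter_upwards [hc] with s hs
  simp only [p] at hs
  linarith

theorem HasWeakDeriv.eq_zero {L : ℝ} {g : L2 L} (h : HasWeakDeriv L 0 g) : g = 0 := by
  have key : ∀ᵐ x, x ∈ Ioo 0 L → g x = 0 := by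
    apply IsOpen.ae_eq_zero_of_integral_contDiff_smul_eq_zero isOpen_Ioo
    · exact IntegrableOn.locallyIntegrableOn (integrable_L2 g)
    · intro ψ hψ hs ht
      rw [← setIntegral_eq_integral_of_forall_compl_eq_zero (s := Ioo 0 L)
        (fun x hx => by rw [image_eq_zero_of_notMem_tsupport fun h => hx (ht h), zero_smul])]
      have h1 := h ψ hψ hs ht
      have h2 : ∫ s in Ioo 0 L, (0 : L2 L) s * deriv ψ s = 0 := by
        rw [integral_congr_ae (g := fun _ => (0 : ℝ)), integral_zero]
        filter_upwards [Lp.coeFn_zero ℝ 2 (volI L)] with s hs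
        rw [hs, Pi.zero_apply, zero_mul]
      rw [h2] at h1
      simp only [smul_eq_mul, mul_comm (ψ _)]
      linarith
  rw [Lp.eq_zero_iff_ae_eq_zero]
  rw [Filter.EventuallyEq, ae_restrict_iff' measurableSet_Ioo]
  exact key

theorem ae_uIcc_of_ae_volI {L : ℝ} (hL : 0 ≤ L) {P : ℝ → Prop} (h : ∀ᵐ s ∂(volI L), P s) :
    ∀ᵐ x, x ∈ uIcc 0 L → P x := by
  rw [uIcc_of_le hL, ← ae_restrict_iff' measurableSet_Icc]
  rwa [volI, restrict_Ioo_eq_restrict_Icc] at h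

theorem inner_L2 {L : ℝ} (f g : L2 L) : inner ℝ f g = ∫ s in Ioo 0 L, f s * g s := by
  rw [L2.inner_def]
  simp [mul_comm]

theorem integral_mul_L2_congr {L : ℝ} {f g : ℝ → ℝ} {f' g' : L2 L} (hf : f =ᵐ[volI L] f')
    (hg : g =ᵐ[volI L] g') : ∫ s in Ioo 0 L, f s * g s = inner ℝ f' g' := by
  rw [inner_L2]
  apply integral_congr_ae
  filter_upwards [hf, hg] with s h1 h2
  rw [h1, h2]

theorem integral_abs_mul_abs_le {L : ℝ} (f g : L2 L) :
    ∫ s in Ioo 0 L, |f s| * |g s| ≤ ‖f‖ * ‖g‖ := by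
  rw [integral_mul_L2_congr (f' := |f|) (g' := |g|) (Lp.coeFn_abs f).symm (Lp.coeFn_abs g).symm,
    ← norm_abs_eq_norm f, ← norm_abs_eq_norm g]
  exact real_inner_le_norm _ _

theorem norm_sq_L2 {L : ℝ} (f : L2 L) : ‖f‖ ^ 2 = ∫ s in Ioo 0 L, f s * f s := by
  rw [← inner_L2, real_inner_self_eq_norm_sq]

theorem integrable_mul_L2 {L : ℝ} (f g : L2 L) : Integrable (fun s => f s * g s) (volI L) :=
  (Lp.memLp f).integrable_mul (Lp.memLp g)

theorem exists_mul_L2 {L : ℝ} {p : ℝ → ℝ} (hp : AEStronglyMeasurable p (volI L)) {c : ℝ}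
    (hc : ∀ᵐ s ∂(volI L), |p s| ≤ c) (f : L2 L) :
    ∃ g : L2 L, g =ᵐ[volI L] (fun s => p s * f s) ∧ ‖g‖ ≤ c * ‖f‖ := by
  have h : MemLp (fun s => p s * f s) 2 (volI L) := by
    refine (Lp.memLp f).of_le_mul (c := c) (hp.mul (Lp.aestronglyMeasurable f)) ?_
    filter_upwards [hc] with s hs
    rw [norm_mul]
    exact mul_le_mul_of_nonneg_right hs (norm_nonneg _)
  refine ⟨h.toLp _, h.coeFn_toLp, ?_⟩
  apply Lp.norm_le_mul_norm_of_ae_le_mul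
  filter_upwards [hc, h.coeFn_toLp] with s hs hs'
  rw [hs', norm_mul]
  exact mul_le_mul_of_nonneg_right hs (norm_nonneg _)

/-! ### The Hilbert space structure of `H²` -/

/-- For a fixed test function both sides of the defining identity are L² inner products, hence
continuous. An intersection of such closed conditions is closed, which makes `H2` complete. -/
theorem isClosed_hasWeakDeriv (L : ℝ) (i j : Fin 3) :
    IsClosed {u : PiLp 2 (fun _ : Fin 3 => L2 L) | HasWeakDeriv L (u i) (u j)} := by
  have key : ∀ (k : Fin 3) (ψ : ℝ → ℝ), Continuous ψ → HasCompactSupport ψ →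
      Continuous (fun u : PiLp 2 (fun _ : Fin 3 => L2 L) => ∫ s in Ioo 0 L, u k s * ψ s) := by
    intro k ψ hc hs
    have h1 : MemLp ψ 2 (volI L) := (hc.memLp_of_hasCompactSupport hs).restrict _
    have : (fun u : PiLp 2 (fun _ : Fin 3 => L2 L) => ∫ s in Ioo 0 L, u k s * ψ s)
        = fun u => inner ℝ (u k) (h1.toLp ψ) := by
      ext u
      exact integral_mul_L2_congr Filter.EventuallyEq.rfl h1.coeFn_toLp.symm
    rw [this]
    fun_prop
  simp only [HasWeakDeriv, ofPred_forall]
  refine isClosed_iInter fun φ => isClosed_iInter fun hφ => isClosed_iInter fun hs =>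
    isClosed_iInter fun ht => ?_
  exact isClosed_eq (key i _ (hφ.continuous_deriv (by simp)) hs.deriv)
    (key j _ hφ.continuous hs).neg

instance (L : ℝ) : CompleteSpace (H2 L) := by
  have : IsClosed (H2 L : Set (PiLp 2 (fun _ : Fin 3 => L2 L))) :=
    (isClosed_hasWeakDeriv L 0 1).inter (isClosed_hasWeakDeriv L 1 2)
  exact this.completeSpace_coe

/-- The `j`-th derivative as a continuous linear map. -/
def DL {L : ℝ} (j : Fin 3) : H2 L →L[ℝ] L2 L :=
  (PiLp.proj (𝕜 := ℝ) 2 (fun _ : Fin 3 => L2 L) j).comp (H2 L).subtypeL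

theorem D_add {L : ℝ} (j : Fin 3) (u v : H2 L) : D j (u + v) = D j u + D j v := rfl
theorem D_sub {L : ℝ} (j : Fin 3) (u v : H2 L) : D j (u - v) = D j u - D j v := rfl
theorem D_smul {L : ℝ} (j : Fin 3) (c : ℝ) (u : H2 L) : D j (c • u) = c • D j u := rfl

theorem norm_sq_H2 {L : ℝ} (u : H2 L) :
    ‖u‖ ^ 2 = ‖D 0 u‖ ^ 2 + ‖D 1 u‖ ^ 2 + ‖D 2 u‖ ^ 2 := by
  have h := PiLp.norm_sq_eq_of_L2 (fun _ : Fin 3 => L2 L) (u : PiLp 2 (fun _ : Fin 3 => L2 L))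
  rw [Fin.sum_univ_three] at h
  exact h

theorem norm_D_le {L : ℝ} (j : Fin 3) (u : H2 L) : ‖D j u‖ ≤ ‖u‖ := by
  have h := norm_sq_H2 u
  apply le_of_sq_le_sq _ (norm_nonneg _)
  fin_cases j <;> simp only [Fin.reduceFinMk, Fin.zero_eta, Fin.mk_one] <;> nlinarith [sq_nonneg ‖D 0 u‖, sq_nonneg ‖D 1 u‖, sq_nonneg ‖D 2 u‖]

theorem norm_H2_le {L : ℝ} (u : H2 L) : ‖u‖ ≤ ‖D 0 u‖ + ‖D 1 u‖ + ‖D 2 u‖ := by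
  have h := norm_sq_H2 u
  have h0 := norm_nonneg (D 0 u)
  have h1 := norm_nonneg (D 1 u)
  have h2 := norm_nonneg (D 2 u)
  apply le_of_sq_le_sq _ (by positivity)
  rw [h]
  nlinarith [mul_nonneg h0 h1, mul_nonneg h0 h2, mul_nonneg h1 h2]

/-- Weak derivatives are determined by the function, so identities in `H2` need only be checked on
`D 0`. -/
theorem D_zero_injective (L : ℝ) : Function.Injective (D 0 : H2 L → L2 L) := by
  intro u v huv
  have h0 : D 0 (u - v) = 0 := by rw [D_sub, huv, sub_self]
  have h1 : D 1 (u - v) = 0 := by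
    apply HasWeakDeriv.eq_zero
    have := (u - v).2.1
    change HasWeakDeriv L (D 0 (u - v)) (D 1 (u - v)) at this
    rwa [h0] at this
  have h2 : D 2 (u - v) = 0 := by
    apply HasWeakDeriv.eq_zero
    have := (u - v).2.2
    change HasWeakDeriv L (D 1 (u - v)) (D 2 (u - v)) at this
    rwa [h1] at this
  have := norm_H2_le (u - v)
  rw [h0, h1, h2] at this
  simp only [norm_zero, add_zero] at this
  exact sub_eq_zero.1 (norm_le_zero_iff.1 this)

theorem IsPrimitive.hasWeakDeriv {L : ℝ} (hL : 0 ≤ L) {p q : ℝ → ℝ} (h : IsPrimitive L p q)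
    {f g : L2 L} (hf : f =ᵐ[volI L] p) (hg : g =ᵐ[volI L] q) : HasWeakDeriv L f g := by
  intro φ hφ hs ht
  have h1 : ∫ s in Ioo 0 L, f s * deriv φ s = ∫ s in Ioo 0 L, p s * deriv φ s := by
    apply integral_congr_ae
    filter_upwards [hf] with s hs using by rw [hs]
  have h2 : ∫ s in Ioo 0 L, g s * φ s = ∫ s in Ioo 0 L, q s * φ s := by
    apply integral_congr_ae
    filter_upwards [hg] with s hs using by rw [hs]
  rw [h1, h2, h.integral_mul_test hL hφ ht]

/-- Elements of `H²` given by twice differentiable functions. -/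
theorem exists_H2 {L : ℝ} (hL : 0 ≤ L) {p q r : ℝ → ℝ} (h₁ : IsPrimitive L p q)
    (h₂ : IsPrimitive L q r) {f₀ f₁ f₂ : L2 L} (e₀ : f₀ =ᵐ[volI L] p) (e₁ : f₁ =ᵐ[volI L] q)
    (e₂ : f₂ =ᵐ[volI L] r) : ∃ w : H2 L, D 0 w = f₀ ∧ D 1 w = f₁ ∧ D 2 w = f₂ := by
  refine ⟨⟨WithLp.toLp 2 ![f₀, f₁, f₂], ?_, ?_⟩, rfl, rfl, rfl⟩
  · exact h₁.hasWeakDeriv hL e₀ e₁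
  · exact h₂.hasWeakDeriv hL e₁ e₂

/-! ### Embedding of H² into C¹ and interpolation. -/

/-- Agmon's inequality. -/
theorem IsPrimitive.agmon {L : ℝ} (hL : 0 < L) {w : ℝ → ℝ} {f g : L2 L} (h : IsPrimitive L w g)
    (hf : f =ᵐ[volI L] w) {x : ℝ} (hx : x ∈ uIcc 0 L) :
    w x ^ 2 ≤ ‖f‖ ^ 2 / L + 2 * (‖f‖ * ‖g‖) := by
  have ia : Integrable (fun s => |f s| * |g s|) (volI L) := by
    simpa [abs_mul] using (integrable_mul_L2 f g).abs
  -- The difference w(x)² − w(y)² is the integral of 2ww' between y and x. The resulting bound is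
  -- then averaged over y in (0, L).
  have hb : ∀ᵐ y ∂(volI L), w x ^ 2 ≤ f y * f y + 2 * (‖f‖ * ‖g‖) := by
    filter_upwards [hf, ae_restrict_mem measurableSet_Ioo] with y hy hyI
    have hy' : y ∈ uIcc 0 L := by
      rw [uIcc_of_le hL.le]; exact Ioo_subset_Icc_self hyI
    have h1 := (h.mul h).integral_eq_sub hy' hx
    have h2 : |∫ s in y..x, (g s * w s + w s * g s)| ≤ 2 * (‖f‖ * ‖g‖) := by
      refine (intervalIntegral.norm_integral_le_integral_norm_uIoc (E := ℝ)).trans ?_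
      simp only [Real.norm_eq_abs]
      calc ∫ s in uIoc y x, |g s * w s + w s * g s|
          ≤ ∫ s in Ioc 0 L, |g s * w s + w s * g s| := by
            apply setIntegral_mono_set
            · have := (h.mul h).intervalIntegrable.abs
              rwa [intervalIntegrable_iff_integrableOn_Ioc_of_le hL.le] at this
            · exact Filter.Eventually.of_forall fun s => abs_nonneg _
            · have := uIoc_subset_uIoc_of_uIcc_subset_uIcc (uIcc_subset_uIcc hy' hx)
              rw [uIoc_of_le hL.le] at this
              exact this.eventuallyLE
        _ = ∫ s in Ioo 0 L, 2 * (|f s| * |g s|) := by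
            rw [integral_Ioc_eq_integral_Ioo]
            apply integral_congr_ae
            filter_upwards [hf] with s hs
            rw [hs, show g s * w s + w s * g s = 2 * (w s * g s) by ring, abs_mul, abs_mul, abs_two]
        _ ≤ 2 * (‖f‖ * ‖g‖) := by
            rw [integral_const_mul]
            gcongr
            exact integral_abs_mul_abs_le f g
    have h3 := (abs_le.1 h2).2
    rw [h1] at h3
    rw [hy]
    nlinarith
  have h4 := integral_mono_ae (integrable_const _) ((integrable_mul_L2 f f).add (integrable_const _)) hb
  simp only [Pi.add_apply] at h4
  rw [integral_add (integrable_mul_L2 f f) (integrable_const _), ← norm_sq_L2] at h4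
  simp only [integral_const, measureReal_restrict_apply_univ, Real.volume_real_Ioo_of_le hL.le,
    smul_eq_mul, sub_zero] at h4
  have h5 : L * (‖f‖ ^ 2 / L + 2 * (‖f‖ * ‖g‖)) = ‖f‖ ^ 2 + L * (2 * (‖f‖ * ‖g‖)) := by
    field_simp
  refine le_of_mul_le_mul_left (h4.trans_eq h5.symm) hL

/-- The constant of the embedding of `H¹(0, L)` into `C[0, L]`. -/
def supConst (L : ℝ) : ℝ := Real.sqrt (1 / L + 2)

theorem supConst_nonneg (L : ℝ) : 0 ≤ supConst L := Real.sqrt_nonneg _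

/-- Every `u ∈ H²(0, L)` has a `C¹` representative, whose derivative is absolutely continuous. -/
theorem H2.exists_primitive {L : ℝ} (hL : 0 < L) (u : H2 L) :
    ∃ p q : ℝ → ℝ, IsPrimitive L p q ∧ IsPrimitive L q (D 2 u) ∧ D 0 u =ᵐ[volI L] p ∧
      D 1 u =ᵐ[volI L] q ∧
      (∀ x ∈ uIcc 0 L, p x ^ 2 ≤ ‖D 0 u‖ ^ 2 / L + 2 * (‖D 0 u‖ * ‖D 1 u‖)) ∧
      (∀ x ∈ uIcc 0 L, q x ^ 2 ≤ ‖D 1 u‖ ^ 2 / L + 2 * (‖D 1 u‖ * ‖D 2 u‖)) ∧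
      (∀ x ∈ uIcc 0 L, |p x| ≤ supConst L * ‖u‖) ∧
      (∀ x ∈ uIcc 0 L, |q x| ≤ supConst L * ‖u‖) := by
  obtain ⟨p, hp, hp'⟩ := HasWeakDeriv.exists_primitive hL u.2.1
  obtain ⟨q, hq, hq'⟩ := HasWeakDeriv.exists_primitive hL u.2.2
  have a1 := fun x hx => hp.agmon hL hp' (x := x) hx
  have a2 := fun x hx => hq.agmon hL hq' (x := x) hx
  have key : ∀ (i j : Fin 3) (t : ℝ), t ^ 2 ≤ ‖D i u‖ ^ 2 / L + 2 * (‖D i u‖ * ‖D j u‖) →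
      |t| ≤ supConst L * ‖u‖ := by
    intro i j t ht
    have hi := norm_D_le i u
    have hj := norm_D_le j u
    apply abs_le_of_sq_le_sq _ (mul_nonneg (supConst_nonneg L) (norm_nonneg _))
    rw [mul_pow, supConst, Real.sq_sqrt (by positivity)]
    refine ht.trans ?_
    calc ‖D i u‖ ^ 2 / L + 2 * (‖D i u‖ * ‖D j u‖) ≤ ‖u‖ ^ 2 / L + 2 * (‖u‖ * ‖u‖) := by gcongr
      _ = (1 / L + 2) * ‖u‖ ^ 2 := by ring
  exact ⟨p, q, hp.congr_right (ae_uIcc_of_ae_volI hL.le hq'), hq, hp', hq', a1, a2,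
    fun x hx => key 0 1 _ (a1 x hx), fun x hx => key 1 2 _ (a2 x hx)⟩

theorem abs_D_one_le {L : ℝ} (hL : 0 < L) (u : H2 L) :
    ∀ᵐ s ∂(volI L), |D 1 u s| ≤ supConst L * ‖u‖ := by
  obtain ⟨p, q, -, -, -, h, -, -, -, hq⟩ := H2.exists_primitive hL u
  filter_upwards [h, ae_restrict_mem measurableSet_Ioo] with s hs hsI
  rw [hs]
  apply hq
  rw [uIcc_of_le hL.le]
  exact Ioo_subset_Icc_self hsI

/-- An interpolation inequality between `L²` and `H²`. -/
theorem exists_interpolation {L : ℝ} (hL : 0 < L) : ∃ C : ℝ, 1 ≤ C ∧ ∀ (u : H2 L) (η : ℝ),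
    0 < η → η ≤ 1 → ‖D 1 u‖ ≤ C * (‖D 0 u‖ / η + η * ‖D 2 u‖) := by
  -- Chosen so that 1/(LK) + 1/K = 1/4, which lets the part of the boundary term containing ‖u'‖² be
  -- absorbed on the left.
  set K : ℝ := 4 * (1 + 1 / L) with hK
  have hK4 : 4 ≤ K := by rw [hK]; have : 0 < 1 / L := by positivity
                         linarith
  have hKL : 1 / (L * K) + 1 / K ≤ 1 / 4 := by
    rw [hK]; apply le_of_eq; field_simp; ring
  have hC : 1 ≤ 2 * (K / L + 4 * K ^ 2 + 1) := by
    have : 0 < K / L := by positivity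
    nlinarith
  refine ⟨Real.sqrt (2 * (K / L + 4 * K ^ 2 + 1)), by rwa [Real.one_le_sqrt], ?_⟩
  intro u η hη hη1
  obtain ⟨p, q, hp, hq, e0, e1, ap, aq, -, -⟩ := H2.exists_primitive hL u
  set a := ‖D 0 u‖
  set X := ‖D 1 u‖
  set b := ‖D 2 u‖
  have ha : 0 ≤ a := norm_nonneg _
  have hX : 0 ≤ X := norm_nonneg _
  have hb : 0 ≤ b := norm_nonneg _
  -- Integration by parts: ∫ u'² = [u u'] − ∫ u u''.
  have h1 : X ^ 2 = p L * q L - p 0 * q 0 - inner ℝ (D 0 u) (D 2 u) := by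
    have h := hq.integral_mul hL.le hp
    rw [integral_mul_L2_congr e1.symm e1.symm, real_inner_self_eq_norm_sq,
      integral_mul_L2_congr Filter.EventuallyEq.rfl e0.symm, real_inner_comm] at h
    linarith
  have h2 : -inner ℝ (D 0 u) (D 2 u) ≤ a * b :=
    (neg_le_abs _).trans (abs_real_inner_le_norm _ _)
  have hpq : ∀ x ∈ uIcc 0 L, 2 * |p x * q x| ≤ K / η * (a ^ 2 / L + 2 * (a * X))
      + η / K * (X ^ 2 / L + 2 * (X * b)) := by
    intro x hx
    -- Young's inequality with weight K/η; Agmon's inequality then bounds both boundary values.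
    have hy : 2 * |p x * q x| ≤ K / η * p x ^ 2 + η / K * q x ^ 2 := by
      have hs : 0 < K / η := by positivity
      have e : η / K = (K / η)⁻¹ := by rw [inv_div]
      rw [e, abs_mul, ← sq_abs (p x), ← sq_abs (q x)]
      have : K / η * |p x| ^ 2 + (K / η)⁻¹ * |q x| ^ 2 - 2 * (|p x| * |q x|)
          = (K / η)⁻¹ * (K / η * |p x| - |q x|) ^ 2 := by field_simp; ring
      have h0 : 0 ≤ (K / η)⁻¹ * (K / η * |p x| - |q x|) ^ 2 := by positivity
      linarith
    refine hy.trans ?_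
    gcongr
    · exact ap x hx
    · exact aq x hx
  have h3 : X ^ 2 ≤ K / η * (a ^ 2 / L + 2 * (a * X)) + η / K * (X ^ 2 / L + 2 * (X * b))
      + a * b := by
    have := hpq 0 (by simp)
    have := hpq L (by simp)
    have := le_abs_self (p L * q L)
    have := neg_le_abs (p 0 * q 0)
    linarith
  -- In the scaled variables α = ‖u‖/η and β = η‖u''‖ the claim no longer involves η.
  set α := a / η with hα
  have hα0 : 0 ≤ α := by positivity
  set β := η * b with hβ
  have hβ0 : 0 ≤ β := by positivity
  have t1 : K / η * (a ^ 2 / L + 2 * (a * X)) ≤ K / L * α ^ 2 + (X ^ 2 / 4 + 4 * K ^ 2 * α ^ 2) := by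
    have s1 : K / η * (a ^ 2 / L + 2 * (a * X)) = K / L * (η * α ^ 2) + 2 * K * α * X := by
      rw [hα]; field_simp
    have s2 : η * α ^ 2 ≤ α ^ 2 := mul_le_of_le_one_left (sq_nonneg _) hη1
    have s3 : K / L * (η * α ^ 2) ≤ K / L * α ^ 2 := by gcongr
    rw [s1]
    nlinarith [sq_nonneg (X / 2 - 2 * K * α)]
  have t2 : η / K * (X ^ 2 / L + 2 * (X * b)) ≤ X ^ 2 / 4 + β ^ 2 / 4 := by
    have s1 : η / K * (X ^ 2 / L + 2 * (X * b)) = η * (1 / (L * K) * X ^ 2) + 1 / K * (2 * X * β) := by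
      rw [hβ]; field_simp
    have s2 : η * (1 / (L * K) * X ^ 2) ≤ 1 / (L * K) * X ^ 2 :=
      mul_le_of_le_one_left (by positivity) hη1
    have s3 : 1 / K * (2 * X * β) ≤ 1 / K * (X ^ 2 + β ^ 2) := by
      gcongr; nlinarith [sq_nonneg (X - β)]
    have s4 : 1 / K ≤ 1 / 4 := by gcongr
    have s5 : (1 / (L * K) + 1 / K) * X ^ 2 ≤ 1 / 4 * X ^ 2 := by gcongr
    have s6 : 1 / K * β ^ 2 ≤ 1 / 4 * β ^ 2 := by gcongr
    rw [s1]
    linarith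
  have t3 : a * b ≤ α ^ 2 / 2 + β ^ 2 / 2 := by
    have : a * b = α * β := by rw [hα, hβ]; field_simp
    rw [this]; nlinarith [sq_nonneg (α - β)]
  have t4 : X ^ 2 ≤ 2 * (K / L + 4 * K ^ 2 + 1) * (α + β) ^ 2 := by
    have hk : 0 ≤ K / L := by positivity
    have u1 : (α + β) ^ 2 ≥ α ^ 2 + β ^ 2 := by nlinarith [mul_nonneg hα0 hβ0]
    have u2 : X ^ 2 ≤ 2 * (K / L + 4 * K ^ 2 + 1) * (α ^ 2 + β ^ 2) := by
      have k1 := mul_nonneg hk (sq_nonneg β)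
      have k2 := mul_nonneg (sq_nonneg K) (sq_nonneg β)
      have k3 := sq_nonneg α
      have k4 := sq_nonneg β
      have k5 : X ^ 2 ≤ K / L * α ^ 2 + (X ^ 2 / 4 + 4 * K ^ 2 * α ^ 2) + (X ^ 2 / 4 + β ^ 2 / 4)
          + (α ^ 2 / 2 + β ^ 2 / 2) := by linarith
      clear_value α β X K a b
      clear h1 h2 h3 t1 t2 t3
      generalize K / L = k at *
      linarith
    exact u2.trans (by gcongr)
  apply le_of_sq_le_sq _ (by positivity)
  rw [mul_pow, Real.sq_sqrt (by positivity)]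
  exact t4

/-! ### Multiplication in `H²` -/

theorem aestronglyMeasurable_of_continuousOn {L : ℝ} (hL : 0 ≤ L) {p : ℝ → ℝ}
    (h : ContinuousOn p (uIcc 0 L)) : AEStronglyMeasurable p (volI L) := by
  rw [uIcc_of_le hL] at h
  exact (h.mono Ioo_subset_Icc_self).aestronglyMeasurable measurableSet_Ioo

theorem ae_volI_of_forall {L : ℝ} (hL : 0 ≤ L) {P : ℝ → Prop} (h : ∀ x ∈ uIcc 0 L, P x) :
    ∀ᵐ s ∂(volI L), P s := by
  filter_upwards [ae_restrict_mem measurableSet_Ioo] with s hs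
  apply h
  rw [uIcc_of_le hL]
  exact Ioo_subset_Icc_self hs

/-- In each term of the Leibniz formulas for uv, (uv)', (uv)'', one factor has order at most one and
is bounded by the sup-norm embedding. The constant 7 = 1 + 2 + 4 counts these terms. -/
theorem exists_H2_mul {L : ℝ} (hL : 0 < L) (u v : H2 L) :
    ∃ w : H2 L, D 0 w =ᵐ[volI L] (fun s => D 0 u s * D 0 v s) ∧
      ‖w‖ ≤ 7 * supConst L * ‖u‖ * ‖v‖ := by
  obtain ⟨p, q, hp, hq, e0, e1, -, -, bp, bq⟩ := H2.exists_primitive hL u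
  obtain ⟨p', q', hp', hq', e0', e1', -, -, bp', bq'⟩ := H2.exists_primitive hL v
  have mp := aestronglyMeasurable_of_continuousOn hL.le hp.continuousOn
  have mq := aestronglyMeasurable_of_continuousOn hL.le hq.continuousOn
  have mp' := aestronglyMeasurable_of_continuousOn hL.le hp'.continuousOn
  obtain ⟨g0, hg0, n0⟩ := exists_mul_L2 mp (ae_volI_of_forall hL.le bp) (D 0 v)
  obtain ⟨g1, hg1, n1⟩ := exists_mul_L2 mp' (ae_volI_of_forall hL.le bp') (D 1 u)
  obtain ⟨g2, hg2, n2⟩ := exists_mul_L2 mp (ae_volI_of_forall hL.le bp) (D 1 v)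
  obtain ⟨g3, hg3, n3⟩ := exists_mul_L2 mp' (ae_volI_of_forall hL.le bp') (D 2 u)
  obtain ⟨g4, hg4, n4⟩ := exists_mul_L2 mq (ae_volI_of_forall hL.le bq) (D 1 v)
  obtain ⟨g5, hg5, n5⟩ := exists_mul_L2 mp (ae_volI_of_forall hL.le bp) (D 2 v)
  obtain ⟨w, w0, w1, w2⟩ := exists_H2 hL.le (hp.mul hp') ((hq.mul hp').add (hp.mul hq'))
    (f₀ := g0) (f₁ := g1 + g2) (f₂ := g3 + g4 + (g4 + g5))
    (by filter_upwards [hg0, e0'] with s h1 h2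
        rw [h1, h2])
    (by filter_upwards [Lp.coeFn_add g1 g2, hg1, hg2, e1, e1'] with s h1 h2 h3 h4 h5
        rw [h1, Pi.add_apply, h2, h3, h4, h5]; ring)
    (by filter_upwards [Lp.coeFn_add (g3 + g4) (g4 + g5), Lp.coeFn_add g3 g4, Lp.coeFn_add g4 g5,
          hg3, hg4, hg5, e1'] with s h1 h2 h3 h4 h5 h6 h7
        rw [h1, Pi.add_apply, h2, h3, Pi.add_apply, Pi.add_apply, h4, h5, h6, h7]; ring)
  refine ⟨w, ?_, ?_⟩
  · rw [w0]
    filter_upwards [hg0, e0] with s h1 h2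
    rw [h1, h2]
  · have hS := supConst_nonneg L
    have hu : 0 ≤ supConst L * ‖u‖ := by positivity
    have hv : 0 ≤ supConst L * ‖v‖ := by positivity
    have k0 := n0.trans (mul_le_mul_of_nonneg_left (norm_D_le 0 v) hu)
    have k1 := n1.trans (mul_le_mul_of_nonneg_left (norm_D_le 1 u) hv)
    have k2 := n2.trans (mul_le_mul_of_nonneg_left (norm_D_le 1 v) hu)
    have k3 := n3.trans (mul_le_mul_of_nonneg_left (norm_D_le 2 u) hv)
    have k4 := n4.trans (mul_le_mul_of_nonneg_left (norm_D_le 1 v) hu)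
    have k5 := n5.trans (mul_le_mul_of_nonneg_left (norm_D_le 2 v) hu)
    have := norm_H2_le w
    rw [w0, w1, w2] at this
    have := norm_add_le g1 g2
    have := norm_add_le (g3 + g4) (g4 + g5)
    have := norm_add_le g3 g4
    have := norm_add_le g4 g5
    nlinarith

/-- `H²(0, L)` is a Banach algebra under pointwise multiplication. -/
theorem exists_mulL {L : ℝ} (hL : 0 < L) : ∃ M : H2 L →L[ℝ] H2 L →L[ℝ] H2 L,
    ∀ u v, D 0 (M u v) =ᵐ[volI L] (fun s => D 0 u s * D 0 v s) := by
  choose w hw hn using exists_H2_mul hL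
  have ext : ∀ {a b : H2 L}, D 0 a =ᵐ[volI L] D 0 b → a = b := fun h =>
    D_zero_injective L (Lp.ext h)
  refine ⟨LinearMap.mkContinuous₂ (LinearMap.mk₂ ℝ w ?_ ?_ ?_ ?_) (7 * supConst L) hn, hw⟩
  · intro u u' v
    apply ext
    rw [D_add]
    filter_upwards [hw (u + u') v, hw u v, hw u' v, Lp.coeFn_add (D 0 (w u v)) (D 0 (w u' v)),
      Lp.coeFn_add (D 0 u) (D 0 u')] with s h1 h2 h3 h4 h5
    rw [h1, h4, Pi.add_apply, h2, h3, D_add, h5, Pi.add_apply, add_mul]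
  · intro c u v
    apply ext
    rw [D_smul]
    filter_upwards [hw (c • u) v, hw u v, Lp.coeFn_smul c (D 0 (w u v)),
      Lp.coeFn_smul c (D 0 u)] with s h1 h2 h3 h4
    rw [h1, h3, Pi.smul_apply, h2, D_smul, h4, Pi.smul_apply, smul_eq_mul, smul_eq_mul, mul_assoc]
  · intro u v v'
    apply ext
    rw [D_add]
    filter_upwards [hw u (v + v'), hw u v, hw u v', Lp.coeFn_add (D 0 (w u v)) (D 0 (w u v')),
      Lp.coeFn_add (D 0 v) (D 0 v')] with s h1 h2 h3 h4 h5
    rw [h1, h4, Pi.add_apply, h2, h3, D_add, h5, Pi.add_apply, mul_add]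
  · intro c u v
    apply ext
    rw [D_smul]
    filter_upwards [hw u (c • v), hw u v, Lp.coeFn_smul c (D 0 (w u v)),
      Lp.coeFn_smul c (D 0 v)] with s h1 h2 h3 h4
    rw [h1, h3, Pi.smul_apply, h2, D_smul, h4, Pi.smul_apply, smul_eq_mul, smul_eq_mul]; ring

/-- The reciprocal of an element of `H²` which is bounded below by a positive constant. -/
theorem exists_H2_inv {L : ℝ} (hL : 0 < L) (m : H2 L) {c : ℝ} (hc : 0 < c)
    (hm : ∀ᵐ s ∂(volI L), c ≤ D 0 m s) :
    ∃ w : H2 L, ∀ᵐ s ∂(volI L), D 0 m s * D 0 w s = 1 := by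
  obtain ⟨p, q, hp, hq, e0, e1, -⟩ := H2.exists_primitive hL m
  have hpc : ∀ x ∈ uIcc 0 L, c ≤ p x := by
    -- The almost everywhere lower bound passes to the continuous representative, because min(p, c)
    -- and c are continuous and agree almost everywhere.
    have h1 : EqOn (fun x => min (p x) c) (fun _ => c) (Icc 0 L) := by
      apply Measure.eqOn_Icc_of_ae_eq (μ := volume) hL.ne
      · rw [← restrict_Ioo_eq_restrict_Icc]
        filter_upwards [hm, e0] with s h1 h2
        rw [min_eq_right (h2 ▸ h1)]
      · have := hp.continuousOn
        rw [uIcc_of_le hL.le] at this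
        exact ContinuousOn.inf this continuousOn_const
      · exact continuousOn_const
    intro x hx
    rw [uIcc_of_le hL.le] at hx
    have := h1 hx
    exact min_eq_right_iff.1 this
  have hi := hp.inv hc hpc
  have hi2 := hq.neg.mul (hi.mul hi)
  have memc : ∀ {f : ℝ → ℝ}, ContinuousOn f (uIcc 0 L) → MemLp f 2 (volI L) := by
    intro f hf
    obtain ⟨C, hC⟩ := isCompact_uIcc.exists_bound_of_continuousOn hf
    exact MemLp.of_bound (aestronglyMeasurable_of_continuousOn hL.le hf) C
      (ae_volI_of_forall hL.le hC)
  -- In the second derivative of 1/p only the term with p'' is not continuous, and there p'' ∈ L² is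
  -- multiplied by a bounded function.
  have memr : MemLp (fun x => -D 2 m x * ((p x)⁻¹ * (p x)⁻¹) +
      -q x * (-q x * ((p x)⁻¹ * (p x)⁻¹) * (p x)⁻¹ + (p x)⁻¹ * (-q x * ((p x)⁻¹ * (p x)⁻¹))))
      2 (volI L) := by
    have hb : ContinuousOn (fun x => (p x)⁻¹ * (p x)⁻¹) (uIcc 0 L) :=
      hi.continuousOn.mul hi.continuousOn
    obtain ⟨C, hC⟩ := isCompact_uIcc.exists_bound_of_continuousOn hb
    have h1 : MemLp (fun x => -D 2 m x * ((p x)⁻¹ * (p x)⁻¹)) 2 (volI L) := by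
      refine (Lp.memLp (D 2 m)).of_le_mul (c := C) ((Lp.aestronglyMeasurable (D 2 m)).neg.mul
        (aestronglyMeasurable_of_continuousOn hL.le hb)) ?_
      filter_upwards [ae_volI_of_forall hL.le hC] with s hs
      rw [norm_mul, norm_neg, mul_comm]
      exact mul_le_mul_of_nonneg_right hs (norm_nonneg _)
    exact h1.add (memc (hq.neg.continuousOn.mul ((hi2.continuousOn.mul hi.continuousOn).add
      (hi.continuousOn.mul hi2.continuousOn))))
  obtain ⟨w, w0, -, -⟩ := exists_H2 hL.le hi hi2 (memc hi.continuousOn).coeFn_toLp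
    (memc hi2.continuousOn).coeFn_toLp (MemLp.coeFn_toLp memr)
  refine ⟨w, ?_⟩
  rw [w0]
  filter_upwards [e0, (memc hi.continuousOn).coeFn_toLp, ae_volI_of_forall hL.le hpc] with s h1 h2 h3
  rw [h1, h2]
  exact mul_inv_cancel₀ (hc.trans_le h3).ne'

instance (L : ℝ) : NormedAddCommGroup (H2 L →L[ℝ] H2 L) := ContinuousLinearMap.toNormedAddCommGroup

instance (L : ℝ) : NormedSpace ℝ (H2 L →L[ℝ] H2 L) := ContinuousLinearMap.toNormedSpace

/-! ### The resolvent operator -/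

section Resolvent

variable {L : ℝ} {m : H2 L} {c : ℝ}

theorem integral_weight {M : H2 L →L[ℝ] H2 L →L[ℝ] H2 L}
    (hM : ∀ u v, D 0 (M u v) =ᵐ[volI L] (fun s => D 0 u s * D 0 v s)) (m u v : H2 L) :
    ∫ s in Ioo 0 L, D 0 m s * D 0 u s * D 0 v s = inner ℝ (D 0 (M m u)) (D 0 v) :=
  integral_mul_L2_congr (hM m u).symm Filter.EventuallyEq.rfl

/-- The bilinear form of the resolvent problem with weight `m`. -/
def energyForm (M : H2 L →L[ℝ] H2 L →L[ℝ] H2 L) (m : H2 L) (ε : ℝ) : H2 L →L[ℝ] H2 L →L[ℝ] ℝ :=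
  (innerSL ℝ : L2 L →L[ℝ] L2 L →L[ℝ] ℝ).bilinearComp ((DL 0).comp (M m)) (DL 0)
    + ε • (innerSL ℝ : L2 L →L[ℝ] L2 L →L[ℝ] ℝ).bilinearComp (DL 2) (DL 2)

theorem energyForm_apply (M : H2 L →L[ℝ] H2 L →L[ℝ] H2 L) (m : H2 L) (ε : ℝ) (u v : H2 L) :
    energyForm M m ε u v
      = inner ℝ (D 0 (M m u)) (D 0 v) + ε * inner ℝ (D 2 u) (D 2 v) := rfl

theorem isWeakSolution_iff {M : H2 L →L[ℝ] H2 L →L[ℝ] H2 L}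
    (hM : ∀ u v, D 0 (M u v) =ᵐ[volI L] (fun s => D 0 u s * D 0 v s)) {ε : ℝ} {f g : ℝ → ℝ}
    {f' g' : L2 L} (hf : f =ᵐ[volI L] f') (hg : g =ᵐ[volI L] g') {u : H2 L} :
    IsWeakSolution ε (D 0 m) f g u ↔
      ∀ v, energyForm M m ε u v = -ε * inner ℝ f' (D 1 v) + inner ℝ g' (D 0 v) := by
  have e1 := integral_weight hM m u
  have e2 : ∀ v : H2 L, ∫ s in Ioo 0 L, D 2 u s * D 2 v s = inner ℝ (D 2 u) (D 2 v) := fun v =>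
    (inner_L2 _ _).symm
  have e3 : ∀ v : H2 L, ∫ s in Ioo 0 L, f s * D 1 v s = inner ℝ f' (D 1 v) := fun v =>
    integral_mul_L2_congr hf Filter.EventuallyEq.rfl
  have e4 : ∀ v : H2 L, ∫ s in Ioo 0 L, g s * D 0 v s = inner ℝ g' (D 0 v) := fun v =>
    integral_mul_L2_congr hg Filter.EventuallyEq.rfl
  simp only [IsWeakSolution, energyForm_apply, e1, e2, e3, e4]

theorem le_energyForm {M : H2 L →L[ℝ] H2 L →L[ℝ] H2 L}
    (hM : ∀ u v, D 0 (M u v) =ᵐ[volI L] (fun s => D 0 u s * D 0 v s))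
    (hm : ∀ᵐ s ∂(volI L), c ≤ D 0 m s) (ε : ℝ) (u : H2 L) :
    c * ‖D 0 u‖ ^ 2 + ε * ‖D 2 u‖ ^ 2 ≤ energyForm M m ε u u := by
  rw [energyForm_apply, real_inner_self_eq_norm_sq]
  gcongr
  rw [norm_sq_L2, inner_L2, ← integral_const_mul]
  apply integral_mono_ae ((integrable_mul_L2 _ _).const_mul c) (integrable_mul_L2 _ _)
  filter_upwards [hm, hM m u] with s h1 h2
  rw [h2, mul_assoc]
  exact mul_le_mul_of_nonneg_right h1 (mul_self_nonneg _)

/-- The form controls only u and u''; interpolation with η = 1 recovers u'. The constant may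
degenerate with ε, as it only serves existence. -/
theorem isCoercive_energyForm (hL : 0 < L) (hc : 0 < c) (hm : ∀ᵐ s ∂(volI L), c ≤ D 0 m s)
    {M : H2 L →L[ℝ] H2 L →L[ℝ] H2 L}
    (hM : ∀ u v, D 0 (M u v) =ᵐ[volI L] (fun s => D 0 u s * D 0 v s)) {ε : ℝ} (hε : 0 < ε) :
    IsCoercive (energyForm M m ε) := by
  obtain ⟨C, hC1, hC⟩ := exists_interpolation hL
  refine ⟨min c ε / (1 + 2 * C ^ 2), by positivity, fun u => ?_⟩
  refine le_trans ?_ (le_energyForm hM hm ε u)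
  have h1 : ‖D 1 u‖ ≤ C * (‖D 0 u‖ + ‖D 2 u‖) := by simpa using hC u 1 one_pos le_rfl
  have h2 : ‖D 1 u‖ ^ 2 ≤ 2 * C ^ 2 * (‖D 0 u‖ ^ 2 + ‖D 2 u‖ ^ 2) := by
    calc ‖D 1 u‖ ^ 2 ≤ (C * (‖D 0 u‖ + ‖D 2 u‖)) ^ 2 := by gcongr
      _ = C ^ 2 * (‖D 0 u‖ + ‖D 2 u‖) ^ 2 := by ring
      _ ≤ C ^ 2 * (2 * (‖D 0 u‖ ^ 2 + ‖D 2 u‖ ^ 2)) := by gcongr; exact add_sq_le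
      _ = _ := by ring
  have h3 : ‖u‖ ^ 2 ≤ (1 + 2 * C ^ 2) * (‖D 0 u‖ ^ 2 + ‖D 2 u‖ ^ 2) := by
    rw [norm_sq_H2]; linarith
  calc min c ε / (1 + 2 * C ^ 2) * ‖u‖ * ‖u‖ = min c ε / (1 + 2 * C ^ 2) * ‖u‖ ^ 2 := by ring
    _ ≤ min c ε / (1 + 2 * C ^ 2) * ((1 + 2 * C ^ 2) * (‖D 0 u‖ ^ 2 + ‖D 2 u‖ ^ 2)) := by gcongr
    _ = min c ε * ‖D 0 u‖ ^ 2 + min c ε * ‖D 2 u‖ ^ 2 := by field_simp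
    _ ≤ _ := by gcongr; exacts [min_le_left _ _, min_le_right _ _]

/-- Lax–Milgram, with the right-hand side represented by a Riesz vector. -/
theorem existsUnique_isWeakSolution (hL : 0 < L) (hc : 0 < c)
    (hm : ∀ᵐ s ∂(volI L), c ≤ D 0 m s) {ε : ℝ} (hε : 0 < ε) {f g : ℝ → ℝ}
    {f' g' : L2 L} (hf : f =ᵐ[volI L] f') (hg : g =ᵐ[volI L] g') :
    ∃! u : H2 L, IsWeakSolution ε (D 0 m) f g u := by
  obtain ⟨M, hM⟩ := exists_mulL hL
  have hco := isCoercive_energyForm hL hc hm hM hε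
  simp only [isWeakSolution_iff hM hf hg]
  set ℓ : H2 L →L[ℝ] ℝ := (-ε) • (innerSL ℝ f').comp (DL 1) + (innerSL ℝ g').comp (DL 0) with hℓ
  have hℓv : ∀ v, -ε * inner ℝ f' (D 1 v) + inner ℝ g' (D 0 v) = ℓ v := fun v => rfl
  simp only [hℓv]
  set w := (InnerProductSpace.toDual ℝ (H2 L)).symm ℓ with hw
  have hwv : ∀ v, inner ℝ w v = ℓ v := fun v => by
    rw [hw, InnerProductSpace.toDual_symm_apply]
  refine ⟨hco.continuousLinearEquivOfBilin.symm w, fun v => ?_, fun u hu => ?_⟩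
  · rw [← hwv, ← hco.continuousLinearEquivOfBilin_apply, ContinuousLinearEquiv.apply_symm_apply]
  · rw [ContinuousLinearEquiv.eq_symm_apply]
    refine (hco.unique_continuousLinearEquivOfBilin fun v => ?_).symm
    rw [hwv, hu]

theorem isWeakSolution_A (hL : 0 < L) (hc : 0 < c)
    (hm : ∀ᵐ s ∂(volI L), c ≤ D 0 m s) {ε : ℝ} (hε : 0 < ε) {f g : ℝ → ℝ}
    {f' g' : L2 L} (hf : f =ᵐ[volI L] f') (hg : g =ᵐ[volI L] g') :
    IsWeakSolution ε (D 0 m) f g (A L ε (D 0 m) f g) := by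
  have h := existsUnique_isWeakSolution hL hc hm hε hf hg
  rw [A, dif_pos h]
  exact h.choose_spec.1

theorem zero_ae_eq_coe_zero (L : ℝ) : (0 : ℝ → ℝ) =ᵐ[volI L] (0 : L2 L) :=
  (Lp.coeFn_zero ℝ 2 (volI L)).symm

theorem norm_le_of_interpolation {C : ℝ}
    (hC : ∀ (u : H2 L) (η : ℝ), 0 < η → η ≤ 1 → ‖D 1 u‖ ≤ C * (‖D 0 u‖ / η + η * ‖D 2 u‖))
    (u : H2 L) : ‖u‖ ≤ (1 + C) * (‖D 0 u‖ + ‖D 2 u‖) := by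
  have h1 : ‖D 1 u‖ ≤ C * (‖D 0 u‖ + ‖D 2 u‖) := by simpa using hC u 1 one_pos le_rfl
  linarith [norm_H2_le u]

/-- The smoothing estimate for `A₁`, with the exact power of `ε`. -/
theorem exists_bound_A₁ (hL : 0 < L) (hc : 0 < c) (hm : ∀ᵐ s ∂(volI L), c ≤ D 0 m s) :
    ∃ C : ℝ, 1 ≤ C ∧ ∀ η : ℝ, 0 < η → η ≤ 1 → ∀ f g : ℝ → ℝ, ∀ f' g' : L2 L, f =ᵐ[volI L] f' →
      g =ᵐ[volI L] g' →
      ‖A₁ L (η ^ 4) (D 0 m) f - A₁ L (η ^ 4) (D 0 m) g‖ ≤ C * η * ‖f' - g'‖ := by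
  obtain ⟨M, hM⟩ := exists_mulL hL
  obtain ⟨C, hC1, hC⟩ := exists_interpolation hL
  -- A common lower bound for the coefficients of ‖u‖² and (η²‖u''‖)² in the energy.
  set c' := min c 1 with hc'
  have hc'0 : 0 < c' := by positivity
  refine ⟨1 + (1 + C) * (2 * C / c'), by have : 0 ≤ (1 + C) * (2 * C / c') := by positivity
                                         linarith, ?_⟩
  intro η hη hη1 f g f' g' hf hg
  have hε : 0 < η ^ 4 := by positivity
  have s1 := (isWeakSolution_iff hM hf (zero_ae_eq_coe_zero L)).1
    (isWeakSolution_A hL hc hm hε hf (zero_ae_eq_coe_zero L))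
  have s2 := (isWeakSolution_iff hM hg (zero_ae_eq_coe_zero L)).1
    (isWeakSolution_A hL hc hm hε hg (zero_ae_eq_coe_zero L))
  change ∀ v, energyForm M m (η ^ 4) (A₁ L (η ^ 4) (D 0 m) f) v = _ at s1
  change ∀ v, energyForm M m (η ^ 4) (A₁ L (η ^ 4) (D 0 m) g) v = _ at s2
  set u := A₁ L (η ^ 4) (D 0 m) f - A₁ L (η ^ 4) (D 0 m) g with hu
  have h1 : energyForm M m (η ^ 4) u u = -η ^ 4 * inner ℝ (f' - g') (D 1 u) := by
    rw [inner_sub_left]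
    have h0 : energyForm M m (η ^ 4) u = energyForm M m (η ^ 4) (A₁ L (η ^ 4) (D 0 m) f)
        - energyForm M m (η ^ 4) (A₁ L (η ^ 4) (D 0 m) g) := map_sub _ _ _
    rw [h0, sub_apply, s1 u, s2 u]
    ring
  have h2 := le_energyForm hM hm (η ^ 4) u
  rw [h1] at h2
  have h3 : -inner ℝ (f' - g') (D 1 u) ≤ ‖f' - g'‖ * ‖D 1 u‖ :=
    (neg_le_abs _).trans (abs_real_inner_le_norm _ _)
  have h4 := hC u η hη hη1
  set a := ‖D 0 u‖
  set b := ‖D 2 u‖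
  set N := ‖f' - g'‖
  have ha : 0 ≤ a := norm_nonneg _
  have hb : 0 ≤ b := norm_nonneg _
  have hN : 0 ≤ N := norm_nonneg _
  -- The energy with ε = η⁴ controls Z². Interpolation at scale η gives η‖u'‖ ≤ C Z, so the forcing
  -- is at most C η³ N Z and Z = O(η³ N). Passing from Z to the H² norm costs η⁻², which leaves one
  -- power of η.
  set Z := a + η ^ 2 * b with hZ
  have hZ0 : 0 ≤ Z := by positivity
  have h5 : c' * Z ^ 2 ≤ 2 * (C * η ^ 3 * N) * Z := by
    have k1 : c' * Z ^ 2 ≤ 2 * (c' * a ^ 2 + c' * (η ^ 4 * b ^ 2)) := by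
      have : Z ^ 2 ≤ 2 * (a ^ 2 + η ^ 4 * b ^ 2) := by
        refine add_sq_le.trans_eq ?_; ring
      nlinarith
    have k2 : c' * a ^ 2 + c' * (η ^ 4 * b ^ 2) ≤ c * a ^ 2 + 1 * (η ^ 4 * b ^ 2) := by
      gcongr; exacts [min_le_left _ _, min_le_right _ _]
    have k3 : η ^ 4 * (N * ‖D 1 u‖) ≤ C * η ^ 3 * N * Z := by
      calc η ^ 4 * (N * ‖D 1 u‖) ≤ η ^ 4 * (N * (C * (a / η + η * b))) := by gcongr
        _ = C * η ^ 3 * N * Z := by rw [hZ]; field_simp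
    have k4 : -η ^ 4 * inner ℝ (f' - g') (D 1 u) ≤ η ^ 4 * (N * ‖D 1 u‖) := by
      calc -η ^ 4 * inner ℝ (f' - g') (D 1 u) = η ^ 4 * (-inner ℝ (f' - g') (D 1 u)) := by ring
        _ ≤ _ := by gcongr
    linarith
  have h6 : Z ≤ 2 * C / c' * η ^ 3 * N := by
    rcases hZ0.eq_or_lt with h | h
    · rw [← h]; positivity
    · have : c' * Z ≤ 2 * (C * η ^ 3 * N) := by
        refine le_of_mul_le_mul_right ?_ h
        nlinarith
      rw [show 2 * C / c' * η ^ 3 * N = (2 * (C * η ^ 3 * N)) / c' by ring, le_div_iff₀ hc'0]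
      linarith
  have h7 : η ^ 2 * (a + b) ≤ Z := by
    have : η ^ 2 * a ≤ a := mul_le_of_le_one_left ha (pow_le_one₀ hη.le hη1)
    rw [hZ]; linarith
  have h8 : a + b ≤ 2 * C / c' * η * N := by
    refine le_of_mul_le_mul_left ?_ (show 0 < η ^ 2 by positivity)
    refine (h7.trans h6).trans_eq ?_
    ring
  calc ‖u‖ ≤ (1 + C) * (a + b) := norm_le_of_interpolation hC u
    _ ≤ (1 + C) * (2 * C / c' * η * N) := by gcongr
    _ = (1 + C) * (2 * C / c') * η * N := by ring
    _ ≤ (1 + (1 + C) * (2 * C / c')) * η * N := by gcongr; linarith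

/-- `A₂` is bounded on `H²`, uniformly in `ε`. -/
theorem exists_A₂L (hL : 0 < L) (hc : 0 < c) (hm : ∀ᵐ s ∂(volI L), c ≤ D 0 m s) :
    ∃ C : ℝ, 0 ≤ C ∧ ∀ ε : ℝ, 0 < ε → ε ≤ 1 → ∃ B : H2 L →L[ℝ] H2 L, ‖B‖ ≤ C ∧
      ∀ (G : H2 L) (g : ℝ → ℝ), g =ᵐ[volI L] D 0 G → A₂ L ε (D 0 m) g = B G := by
  obtain ⟨M, hM⟩ := exists_mulL hL
  obtain ⟨C, hC1, hC⟩ := exists_interpolation hL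
  obtain ⟨m', hm'⟩ := exists_H2_inv hL m hc hm
  have hsc : 0 < Real.sqrt c := Real.sqrt_pos.2 hc
  set K := (1 + C) * (1 / Real.sqrt c + 1) with hK
  have hK0 : 0 ≤ K := by positivity
  refine ⟨(K + 1) * (‖M‖ * ‖m'‖), by positivity, ?_⟩
  intro ε hε hε1
  have z0 := zero_ae_eq_coe_zero L
  choose S hS hS' using fun G : H2 L => existsUnique_isWeakSolution hL hc hm hε
    z0 (Filter.EventuallyEq.refl _ (D 0 G : ℝ → ℝ))
  simp only [isWeakSolution_iff hM z0 (Filter.EventuallyEq.refl _ _), inner_zero_left,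
    mul_zero, zero_add] at hS hS'
  have hadd : ∀ G H, S (G + H) = S G + S H := by
    intro G H
    refine (hS' _ _ fun v => ?_).symm
    rw [map_add, add_apply, hS, hS, D_add, inner_add_left]
  have hsmul : ∀ (r : ℝ) G, S (r • G) = r • S G := by
    intro r G
    refine (hS' _ _ fun v => ?_).symm
    rw [map_smul, smul_apply, hS, D_smul, real_inner_smul_left, smul_eq_mul]
  have hbound : ∀ G, ‖S G‖ ≤ (K + 1) * (‖M‖ * ‖m'‖) * ‖G‖ := by
    intro G
    -- Comparison with w = G/m, the solution for ε = 0. The error e = S G − w satisfies the equation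
    -- with forcing −ε w'''' in weak form. Testing with e itself gives ‖e''‖ ≤ ‖w''‖, where ε
    -- cancels, so the bound is uniform in ε.
    set w := M m' G with hw
    have hwn : ‖w‖ ≤ ‖M‖ * ‖m'‖ * ‖G‖ := M.le_opNorm₂ _ _
    have hmw : D 0 (M m w) = D 0 G := by
      apply Lp.ext
      filter_upwards [hM m w, hM m' G, hm'] with s h1 h2 h3
      rw [h1, h2, ← mul_assoc, h3, one_mul]
    set e := S G - w with he
    have h1 : energyForm M m ε e e = -ε * inner ℝ (D 2 w) (D 2 e) := by
      have h0 : energyForm M m ε e = energyForm M m ε (S G) - energyForm M m ε w := map_sub _ _ _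
      rw [h0, sub_apply, hS G e, energyForm_apply, hmw]
      ring
    have h2 := le_energyForm hM hm ε e
    rw [h1] at h2
    have h3 : -inner ℝ (D 2 w) (D 2 e) ≤ ‖D 2 w‖ * ‖D 2 e‖ :=
      (neg_le_abs _).trans (abs_real_inner_le_norm _ _)
    have hW : ‖D 2 w‖ ≤ ‖w‖ := norm_D_le 2 w
    have hnorm := norm_le_of_interpolation hC e
    set a := ‖D 0 e‖
    set b := ‖D 2 e‖
    set W := ‖D 2 w‖
    have ha : 0 ≤ a := norm_nonneg _
    have hb : 0 ≤ b := norm_nonneg _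
    have hW0 : 0 ≤ W := norm_nonneg _
    have h4 : c * a ^ 2 + ε * b ^ 2 ≤ ε * (W * b) := by
      refine h2.trans ?_
      calc -ε * inner ℝ (D 2 w) (D 2 e) = ε * (-inner ℝ (D 2 w) (D 2 e)) := by ring
        _ ≤ _ := by gcongr
    have h5 : b ≤ W := by
      rcases hb.eq_or_lt with h | h
      · rw [← h]; exact hW0
      · have : ε * b * b ≤ ε * b * W := by nlinarith [mul_nonneg hc.le (sq_nonneg a)]
        exact le_of_mul_le_mul_left this (mul_pos hε h)
    have h6 : a ≤ 1 / Real.sqrt c * W := by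
      apply le_of_sq_le_sq _ (by positivity)
      rw [mul_pow, div_pow, Real.sq_sqrt hc.le, one_pow, one_div_mul_eq_div, le_div_iff₀ hc]
      have k1 : W * b ≤ W ^ 2 := by nlinarith
      have k2 : ε * (W * b) ≤ W * b := mul_le_of_le_one_left (by positivity) hε1
      nlinarith [mul_nonneg hε.le (sq_nonneg b)]
    have h7 : ‖e‖ ≤ K * ‖w‖ := by
      calc ‖e‖ ≤ (1 + C) * (a + b) := hnorm
        _ ≤ (1 + C) * (1 / Real.sqrt c * W + W) := by gcongr
        _ = K * W := by rw [hK]; ring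
        _ ≤ K * ‖w‖ := by gcongr
    calc ‖S G‖ = ‖e + w‖ := by rw [he, sub_add_cancel]
      _ ≤ ‖e‖ + ‖w‖ := norm_add_le _ _
      _ ≤ (K + 1) * ‖w‖ := by linarith
      _ ≤ (K + 1) * (‖M‖ * ‖m'‖ * ‖G‖) := by gcongr
      _ = _ := by ring
  refine ⟨LinearMap.mkContinuous ⟨⟨S, hadd⟩, hsmul⟩ _ hbound,
    LinearMap.mkContinuous_norm_le _ (by positivity) _, ?_⟩
  intro G g hg
  refine hS' G _ fun v => ?_
  have := (isWeakSolution_iff hM z0 hg).1 (isWeakSolution_A hL hc hm hε z0 hg) v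
  rw [inner_zero_left, mul_zero, zero_add] at this
  exact this

end Resolvent

/-! ### The nonlinear term -/

theorem deriv_F (ξ : ℝ) : deriv F ξ = 4 * ξ ^ 3 - 4 * ξ := by
  have h : HasDerivAt F (2 * (ξ ^ 2 - 1) * (2 * ξ)) ξ := by
    have h1 : HasDerivAt (fun x : ℝ => x ^ 2 - 1) (2 * ξ) ξ := by
      simpa using (hasDerivAt_pow 2 ξ).sub_const 1
    simpa [F] using! h1.pow 2
  rw [h.deriv]; ring

/-- F'(x) − F'(y) = 4 (x² + xy + y² − 1)(x − y). The quadratic growth in r is what produces the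
factor 1 + R² later. -/
theorem abs_deriv_F_sub_le {r x y : ℝ} (hx : |x| ≤ r) (hy : |y| ≤ r) :
    |deriv F x - deriv F y| ≤ 4 * (3 * r ^ 2 + 1) * |x - y| := by
  rw [deriv_F, deriv_F,
    show 4 * x ^ 3 - 4 * x - (4 * y ^ 3 - 4 * y) = 4 * (x * x + x * y + y * y - 1) * (x - y) by ring,
    abs_mul, abs_mul, abs_of_pos (four_pos : (0 : ℝ) < 4)]
  have hr : 0 ≤ r := (abs_nonneg x).trans hx
  have h : ∀ s t : ℝ, |s| ≤ r → |t| ≤ r → |s * t| ≤ r ^ 2 := by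
    intro s t hs ht
    rw [abs_mul, sq]
    gcongr
  gcongr
  have h1 := abs_le.1 (h x x hx hx)
  have h2 := abs_le.1 (h x y hx hy)
  have h3 := abs_le.1 (h y y hy hy)
  rw [abs_le]
  constructor <;> linarith [h1.1, h1.2, h2.1, h2.2, h3.1, h3.2]

/-- The nonlinear term `A_{1,ε} F'(u')`. -/
def nonlin (L ε : ℝ) (k : ℝ → ℝ) (u : H2 L) : H2 L := A₁ L ε k (fun s => deriv F (D 1 u s))

theorem memLp_deriv_F {L : ℝ} (hL : 0 < L) (u : H2 L) :
    MemLp (fun s => deriv F (D 1 u s)) 2 (volI L) := by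
  have hc : Continuous (deriv F) := by
    have : deriv F = fun ξ => 4 * ξ ^ 3 - 4 * ξ := funext deriv_F
    rw [this]; fun_prop
  refine MemLp.of_bound (hc.comp_aestronglyMeasurable (Lp.aestronglyMeasurable _))
    (4 * (3 * (supConst L * ‖u‖) ^ 2 + 1) * (supConst L * ‖u‖)) ?_
  filter_upwards [abs_D_one_le hL u] with s hs
  have h := abs_deriv_F_sub_le (y := 0) hs (by simpa using (abs_nonneg _).trans hs)
  rw [deriv_F 0] at h
  simp only [sub_zero, ne_eq, OfNat.ofNat_ne_zero, not_false_eq_true, zero_pow, mul_zero] at h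
  exact h.trans (by gcongr)

/-- The Lipschitz bound for F' on bounded sets, with sup |u'| controlled by the H² norm, is composed
with the smoothing estimate for A₁ at η = ε^(1/4). -/
theorem exists_nonlin_lipschitz {L : ℝ} (hL : 0 < L) {m : H2 L} {c : ℝ} (hc : 0 < c)
    (hm : ∀ᵐ s ∂(volI L), c ≤ D 0 m s) :
    ∃ C : ℝ, 1 ≤ C ∧ ∀ ε : ℝ, 0 < ε → ε ≤ 1 → nonlin L ε (D 0 m) 0 = 0 ∧
      ∀ (R : ℝ) (x y : H2 L), ‖x‖ ≤ R → ‖y‖ ≤ R →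
        ‖nonlin L ε (D 0 m) x - nonlin L ε (D 0 m) y‖
          ≤ C * ε ^ (1 / 4 : ℝ) * (1 + R ^ 2) * ‖x - y‖ := by
  obtain ⟨C, hC1, hC⟩ := exists_bound_A₁ hL hc hm
  set S := supConst L with hS
  have hS0 : 0 ≤ S := supConst_nonneg L
  refine ⟨C * (12 * S ^ 2 + 4), by nlinarith [sq_nonneg S], ?_⟩
  intro ε hε hε1
  refine ⟨?_, ?_⟩
  · have hf : (fun s => deriv F (D 1 (0 : H2 L) s)) =ᵐ[volI L] (0 : L2 L) := by
      have h0 : D 1 (0 : H2 L) = 0 := rfl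
      rw [h0]
      filter_upwards [Lp.coeFn_zero ℝ 2 (volI L)] with s hs
      rw [hs, Pi.zero_apply, deriv_F]; norm_num
    refine (existsUnique_isWeakSolution hL hc hm hε hf (zero_ae_eq_coe_zero L)).unique
      (isWeakSolution_A hL hc hm hε hf (zero_ae_eq_coe_zero L)) ?_
    obtain ⟨M, hM⟩ := exists_mulL hL
    rw [isWeakSolution_iff hM hf (zero_ae_eq_coe_zero L)]
    intro v
    simp
  · intro R x y hx hy
    set η := ε ^ (1 / 4 : ℝ) with hη
    have hη0 : 0 < η := Real.rpow_pos_of_pos hε _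
    have hη1 : η ≤ 1 := Real.rpow_le_one hε.le hε1 (by norm_num)
    have hη4 : η ^ 4 = ε := by
      rw [hη, ← Real.rpow_natCast, ← Real.rpow_mul hε.le]; norm_num
    have h := hC η hη0 hη1 _ _ _ _ (memLp_deriv_F hL x).coeFn_toLp.symm
      (memLp_deriv_F hL y).coeFn_toLp.symm
    rw [hη4] at h
    refine h.trans ?_
    have hn : ‖(memLp_deriv_F hL x).toLp _ - (memLp_deriv_F hL y).toLp _‖
        ≤ 4 * (3 * (S * R) ^ 2 + 1) * ‖D 1 x - D 1 y‖ := by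
      apply Lp.norm_le_mul_norm_of_ae_le_mul
      filter_upwards [abs_D_one_le hL x, abs_D_one_le hL y, (memLp_deriv_F hL x).coeFn_toLp,
        (memLp_deriv_F hL y).coeFn_toLp, Lp.coeFn_sub (D 1 x) (D 1 y),
        Lp.coeFn_sub ((memLp_deriv_F hL x).toLp _) ((memLp_deriv_F hL y).toLp _)]
        with s h1 h2 h3 h4 h5 h6
      rw [h5, h6, Pi.sub_apply, Pi.sub_apply, h3, h4]
      exact abs_deriv_F_sub_le (h1.trans (by gcongr)) (h2.trans (by gcongr))
    have hd : ‖D 1 x - D 1 y‖ ≤ ‖x - y‖ := norm_D_le 1 (x - y)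
    calc C * η * ‖(memLp_deriv_F hL x).toLp _ - (memLp_deriv_F hL y).toLp _‖
        ≤ C * η * (4 * (3 * (S * R) ^ 2 + 1) * ‖x - y‖) := by
          gcongr
          exact hn.trans (by gcongr)
      _ ≤ C * η * ((12 * S ^ 2 + 4) * (1 + R ^ 2) * ‖x - y‖) := by
          refine mul_le_mul_of_nonneg_left (mul_le_mul_of_nonneg_right ?_ (norm_nonneg _))
            (by positivity)
          nlinarith [sq_nonneg S, sq_nonneg R]
      _ = _ := by ring

/-! ### Abstract delay equations in a Banach space -/

section Delay

variable {H : Type*} [NormedAddCommGroup H]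

theorem ae_norm_le_norm {μ : Measure ℝ} (f : Lp H ∞ μ) : ∀ᵐ t ∂μ, ‖f t‖ ≤ ‖f‖ := by
  filter_upwards [ae_le_eLpNormEssSup (f := f) (μ := μ)] with t ht
  rw [Lp.norm_def, eLpNorm_exponent_top, ← toReal_enorm]
  refine ENNReal.toReal_mono ?_ ht
  rw [← eLpNorm_exponent_top]
  exact Lp.eLpNorm_ne_top f

theorem norm_le_of_ae_norm_le {μ : Measure ℝ} {f : Lp H ∞ μ} {C : ℝ} (hC : 0 ≤ C)
    (h : ∀ᵐ t ∂μ, ‖f t‖ ≤ C) : ‖f‖ ≤ C := by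
  rw [Lp.norm_def, eLpNorm_exponent_top]
  exact ENNReal.toReal_le_of_le_ofReal hC (eLpNormEssSup_le_of_ae_bound h)

theorem exists_Lp_top {μ : Measure ℝ} {f : ℝ → H} (hf : AEStronglyMeasurable f μ) {C : ℝ}
    (hC : 0 ≤ C) (h : ∀ᵐ t ∂μ, ‖f t‖ ≤ C) : ∃ w : Lp H ∞ μ, w =ᵐ[μ] f ∧ ‖w‖ ≤ C := by
  have hm := memLp_top_of_bound hf C h
  refine ⟨hm.toLp f, hm.coeFn_toLp, norm_le_of_ae_norm_le hC ?_⟩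
  filter_upwards [h, hm.coeFn_toLp] with t h1 h2
  rwa [h2]

theorem ae_Iio_mono {σ τ : ℝ} (h : σ ≤ τ) {P : ℝ → Prop}
    (hP : ∀ᵐ t ∂(volume.restrict (Iio τ)), P t) : ∀ᵐ t ∂(volume.restrict (Iio σ)), P t :=
  ae_restrict_of_ae_restrict_of_subset (Iio_subset_Iio h) hP

theorem ae_Iio_of_Iio_of_Ioo {σ τ : ℝ} {P : ℝ → Prop}
    (h₁ : ∀ᵐ t ∂(volume.restrict (Iio σ)), P t)
    (h₂ : ∀ᵐ t ∂(volume.restrict (Ioo σ τ)), P t) : ∀ᵐ t ∂(volume.restrict (Iio τ)), P t := by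
  rw [ae_restrict_iff' measurableSet_Iio] at h₁ ⊢
  rw [ae_restrict_iff' measurableSet_Ioo] at h₂
  filter_upwards [h₁, h₂, Measure.ae_ne volume σ] with t h1 h2 h3 ht
  rcases lt_or_gt_of_ne h3 with h | h
  · exact h1 h
  · exact h2 ⟨h, ht⟩

theorem exists_ae_norm_le {μ : Measure ℝ} {f : ℝ → H} (hf : MemLp f ∞ μ) :
    ∃ r : ℝ, 0 ≤ r ∧ ∀ᵐ t ∂μ, ‖f t‖ ≤ r := by
  refine ⟨‖hf.toLp f‖, norm_nonneg _, ?_⟩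
  filter_upwards [ae_norm_le_norm (hf.toLp f), hf.coeFn_toLp] with t h1 h2
  rwa [h2] at h1

/-- The limit of solutions on an increasing family of intervals. -/
theorem exists_glued {τ : ℕ → ℝ} {T : ℝ} (hτT : ∀ n, τ n ≤ T) (hτ : Tendsto τ atTop (𝓝 T))
    {R : ℝ} (hR : 0 ≤ R) (W : ∀ n, Lp H ∞ (volume.restrict (Iio (τ n)))) (hW : ∀ n, ‖W n‖ ≤ R)
    (hc : ∀ n m, ∀ᵐ t ∂(volume.restrict (Iio (min (τ n) (τ m)))), W n t = W m t) :
    ∃ Z : Lp H ∞ (volume.restrict (Iio T)), ‖Z‖ ≤ R ∧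
      ∀ n, ∀ᵐ t ∂(volume.restrict (Iio (τ n))), Z t = W n t := by
  -- Extension by zero makes all terms functions on the line. At almost every t < T the sequence is
  -- eventually constant, so its limit exists and is measurable.
  let f : ℕ → ℝ → H := fun n t => if t < τ n then W n t else 0
  have hf : ∀ n, StronglyMeasurable (f n) := fun n =>
    StronglyMeasurable.ite measurableSet_Iio (Lp.stronglyMeasurable (W n)) stronglyMeasurable_const
  have hc' : ∀ᵐ t ∂(volume.restrict (Iio T)), ∀ n m, t < τ n → t < τ m → W n t = W m t := by
    rw [ae_all_iff]; intro n
    rw [ae_all_iff]; intro m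
    refine ae_restrict_of_ae ?_
    have := hc n m
    rw [ae_restrict_iff' measurableSet_Iio] at this
    filter_upwards [this] with t ht h1 h2 using ht (lt_min h1 h2)
  have hlim : ∀ᵐ t ∂(volume.restrict (Iio T)), ∀ n, t < τ n →
      Tendsto (fun m => f m t) atTop (𝓝 (W n t)) := by
    filter_upwards [hc', ae_restrict_mem measurableSet_Iio] with t h1 ht n hn
    refine tendsto_const_nhds.congr' ?_
    filter_upwards [hτ.eventually_const_lt ht] with m hm
    simp only [f, if_pos hm]
    exact h1 n m hn hm
  have hex : ∀ᵐ t ∂(volume.restrict (Iio T)), ∃ n, t < τ n := by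
    filter_upwards [ae_restrict_mem measurableSet_Iio] with t ht
    exact (hτ.eventually_const_lt ht).exists
  obtain ⟨g, hg, hfg⟩ := exists_stronglyMeasurable_limit_of_tendsto_ae
    (fun n => (hf n).aestronglyMeasurable (μ := volume.restrict (Iio T)))
    (by filter_upwards [hlim, hex] with t h1 ⟨n, hn⟩
        exact ⟨_, h1 n hn⟩)
  have hgW : ∀ n, ∀ᵐ t ∂(volume.restrict (Iio (τ n))), g t = W n t := by
    intro n
    filter_upwards [ae_Iio_mono (hτT n) hlim, ae_Iio_mono (hτT n) hfg,
      ae_restrict_mem measurableSet_Iio] with t h1 h2 ht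
    exact tendsto_nhds_unique h2 (h1 n ht)
  have hgR : ∀ᵐ t ∂(volume.restrict (Iio T)), ‖g t‖ ≤ R := by
    have hWR : ∀ᵐ t ∂(volume.restrict (Iio T)), ∀ n, t < τ n → g t = W n t ∧ ‖W n t‖ ≤ R := by
      rw [ae_all_iff]; intro n
      refine ae_restrict_of_ae ?_
      have h1 : ∀ᵐ t ∂(volume.restrict (Iio (τ n))), g t = W n t ∧ ‖W n t‖ ≤ R := by
        filter_upwards [hgW n, ae_norm_le_norm (W n)] with t h1 h2 using ⟨h1, h2.trans (hW n)⟩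
      rwa [ae_restrict_iff' measurableSet_Iio] at h1
    filter_upwards [hWR, hex] with t h1 ⟨n, hn⟩
    rw [(h1 n hn).1]
    exact (h1 n hn).2
  obtain ⟨Z, hZ, hZR⟩ := exists_Lp_top hg.aestronglyMeasurable hR hgR
  refine ⟨Z, hZR, fun n => ?_⟩
  filter_upwards [hgW n, ae_Iio_mono (hτT n) hZ] with t h1 h2
  rw [h2, h1]

/-- Null sets of times pull back to null sets of delays. Hence the memory term at every single t
depends only on the almost-everywhere class of z. -/
theorem quasiMeasurePreserving_delay {ε : ℝ} (hε : 0 < ε) (t : ℝ) :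
    Measure.QuasiMeasurePreserving (fun a : ℝ => t - ε * a) (volume.restrict (Ioi 0))
      (volume.restrict (Iio t)) := by
  have h1 : Measure.QuasiMeasurePreserving (fun a : ℝ => ε * a) volume volume :=
    ⟨measurable_const_mul ε, by
      rw [Real.map_volume_mul_left hε.ne']
      exact Measure.smul_absolutelyContinuous⟩
  have h2 := (quasiMeasurePreserving_sub_left_of_right_invariant (volume : Measure ℝ) t).comp h1
  refine h2.restrict fun a ha => ?_
  have : 0 < ε * a := mul_pos hε ha
  simpa using this

theorem ae_delay {ε : ℝ} (hε : 0 < ε) {t τ : ℝ} (ht : t ≤ τ) {P : ℝ → Prop}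
    (hP : ∀ᵐ s ∂(volume.restrict (Iio τ)), P s) :
    ∀ᵐ a ∂(volume.restrict (Ioi (0 : ℝ))), P (t - ε * a) :=
  (quasiMeasurePreserving_delay hε t).ae (ae_Iio_mono ht hP)

variable [NormedSpace ℝ H]

/-- The memory term with respect to a bilinear map `Q`. -/
def delay (Q : H →L[ℝ] H →L[ℝ] H) (ε : ℝ) (ρ z : ℝ → H) (t : ℝ) : H :=
  ∫ a in Ioi (0 : ℝ), Q (z (t - ε * a)) (ρ a)

theorem delay_congr {Q : H →L[ℝ] H →L[ℝ] H} {ε : ℝ} (hε : 0 < ε) {ρ z z' : ℝ → H} {t τ : ℝ}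
    (ht : t ≤ τ) (h : ∀ᵐ s ∂(volume.restrict (Iio τ)), z s = z' s) :
    delay Q ε ρ z t = delay Q ε ρ z' t := by
  apply integral_congr_ae
  filter_upwards [ae_delay hε ht h] with a ha
  rw [ha]

theorem norm_bilin_le (Q : H →L[ℝ] H →L[ℝ] H) {x r : H} {K : ℝ} (hx : ‖x‖ ≤ K) :
    ‖Q x r‖ ≤ K * (‖Q‖ * ‖r‖) :=
  calc ‖Q x r‖ ≤ ‖Q‖ * ‖x‖ * ‖r‖ := Q.le_opNorm₂ _ _
    _ ≤ ‖Q‖ * K * ‖r‖ := by gcongr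
    _ = _ := by ring

theorem integrable_delay (Q : H →L[ℝ] H →L[ℝ] H) {ε : ℝ} (hε : 0 < ε) {ρ z : ℝ → H}
    (hρ : Integrable ρ (volume.restrict (Ioi 0))) {t τ K : ℝ} (ht : t ≤ τ)
    (hz : AEStronglyMeasurable z (volume.restrict (Iio τ)))
    (hK : ∀ᵐ s ∂(volume.restrict (Iio τ)), ‖z s‖ ≤ K) :
    Integrable (fun a => Q (z (t - ε * a)) (ρ a)) (volume.restrict (Ioi (0 : ℝ))) := by
  have hm : AEStronglyMeasurable (fun a => z (t - ε * a)) (volume.restrict (Ioi (0 : ℝ))) :=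
    (hz.mono_measure (Measure.restrict_mono (Iio_subset_Iio ht) le_rfl)).comp_quasiMeasurePreserving
      (quasiMeasurePreserving_delay hε t)
  refine Integrable.mono' ((hρ.norm.const_mul ‖Q‖).const_mul K) ?_ ?_
  · exact Q.continuous₂.comp_aestronglyMeasurable (hm.prodMk hρ.aestronglyMeasurable)
  · filter_upwards [ae_delay hε ht hK] with a ha
    exact norm_bilin_le Q ha

theorem norm_delay_le (Q : H →L[ℝ] H →L[ℝ] H) {ε : ℝ} (hε : 0 < ε) {ρ z : ℝ → H}
    (hρ : Integrable ρ (volume.restrict (Ioi 0))) {t τ K : ℝ} (ht : t ≤ τ)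
    (hK : ∀ᵐ s ∂(volume.restrict (Iio τ)), ‖z s‖ ≤ K) :
    ‖delay Q ε ρ z t‖ ≤ K * (‖Q‖ * ∫ a in Ioi (0 : ℝ), ‖ρ a‖) := by
  rw [← integral_const_mul, ← integral_const_mul]
  refine norm_integral_le_of_norm_le ((hρ.norm.const_mul ‖Q‖).const_mul K) ?_
  filter_upwards [ae_delay hε ht hK] with a ha
  exact norm_bilin_le Q ha

/-- The two histories agree before σ and t ≤ σ + h, so the integrand vanishes for a > h/ε. Only
delays in (0, h/ε] contribute, and on this short range the essential bound on ρ replaces its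
integral. -/
theorem norm_delay_sub_le (Q : H →L[ℝ] H →L[ℝ] H) {ε : ℝ} (hε : 0 < ε) {ρ z z' : ℝ → H}
    (hρ : Integrable ρ (volume.restrict (Ioi 0))) {P : ℝ}
    (hP : ∀ᵐ a ∂(volume.restrict (Ioi (0 : ℝ))), ‖Q‖ * ‖ρ a‖ ≤ P) {t τ σ h K d : ℝ}
    (ht : t ≤ τ) (hth : t ≤ σ + h) (hh : 0 ≤ h) (hd : 0 ≤ d)
    (hz : AEStronglyMeasurable z (volume.restrict (Iio τ)))
    (hz' : AEStronglyMeasurable z' (volume.restrict (Iio τ)))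
    (hK : ∀ᵐ s ∂(volume.restrict (Iio τ)), ‖z s‖ ≤ K)
    (hK' : ∀ᵐ s ∂(volume.restrict (Iio τ)), ‖z' s‖ ≤ K)
    (he : ∀ᵐ s ∂(volume.restrict (Iio τ)), s < σ → z s = z' s)
    (hzd : ∀ᵐ s ∂(volume.restrict (Iio τ)), ‖z s - z' s‖ ≤ d) :
    ‖delay Q ε ρ z t - delay Q ε ρ z' t‖ ≤ P * (h / ε) * d := by
  rw [delay, delay, ← integral_sub (integrable_delay Q hε hρ ht hz hK)
    (integrable_delay Q hε hρ ht hz' hK')]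
  have hb : ∀ᵐ a ∂(volume.restrict (Ioi (0 : ℝ))),
      ‖Q (z (t - ε * a)) (ρ a) - Q (z' (t - ε * a)) (ρ a)‖
        ≤ (Ioc 0 (h / ε)).indicator (fun _ => d * P) a := by
    filter_upwards [ae_delay hε ht he, ae_delay hε ht hzd, hP, ae_restrict_mem measurableSet_Ioi]
      with a h1 h2 h3 h4
    rw [← sub_apply, ← map_sub]
    by_cases ha : a ≤ h / ε
    · rw [indicator_of_mem (show a ∈ Ioc 0 (h / ε) from ⟨h4, ha⟩)]
      exact (norm_bilin_le Q h2).trans (by gcongr)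
    · rw [indicator_of_notMem (fun hc => ha hc.2), h1, sub_self, map_zero, zero_apply, norm_zero]
      have := (div_lt_iff₀ hε).1 (not_le.1 ha)
      linarith
  have hi : Integrable ((Ioc 0 (h / ε)).indicator (fun _ : ℝ => d * P))
      (volume.restrict (Ioi (0 : ℝ))) := by
    refine IntegrableOn.integrable_indicator ?_ measurableSet_Ioc
    refine integrableOn_const ?_
    rw [Measure.restrict_apply measurableSet_Ioc]
    exact ((measure_mono inter_subset_left).trans_lt (by simp)).ne
  refine (norm_integral_le_of_norm_le hi hb).trans_eq ?_
  rw [setIntegral_indicator measurableSet_Ioc, inter_eq_self_of_subset_right Ioc_subset_Ioi_self,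
    setIntegral_const, Real.volume_real_Ioc_of_le (by positivity), smul_eq_mul]
  ring

/-- With ρ replaced by a strongly measurable representative, the integrand is jointly measurable in
(t, a), and so is its partial integral in t. -/
theorem stronglyMeasurable_delay (Q : H →L[ℝ] H →L[ℝ] H) (ε : ℝ) {ρ z : ℝ → H}
    (hρ : AEStronglyMeasurable ρ (volume.restrict (Ioi 0))) (hz : StronglyMeasurable z) :
    StronglyMeasurable (delay Q ε ρ z) := by
  have h1 : delay Q ε ρ z = fun t => ∫ a in Ioi (0 : ℝ), Q (z (t - ε * a)) (hρ.mk ρ a) := by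
    ext t
    apply integral_congr_ae
    filter_upwards [hρ.ae_eq_mk] with a ha
    rw [ha]
  rw [h1]
  refine StronglyMeasurable.integral_prod_right
    (f := fun t a => Q (z (t - ε * a)) (hρ.mk ρ a)) ?_
  refine Q.continuous₂.comp_stronglyMeasurable (StronglyMeasurable.prodMk ?_ ?_)
  · exact hz.comp_measurable (by fun_prop)
  · exact hρ.stronglyMeasurable_mk.comp_measurable measurable_snd

/-- The assumptions on the equation `z = N z + ∫ Q (z (· - ε a)) (ρ a) da` on which the contraction
argument rests; `R` is the radius of the ball and `h` the length of the time step. -/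
structure IsDelayProblem (N : H → H) (Q : H →L[ℝ] H →L[ℝ] H) (ε : ℝ) (ρ : ℝ → H)
    (P₁ P h R : ℝ) : Prop where
  ε_pos : 0 < ε
  h_pos : 0 < h
  R_nonneg : 0 ≤ R
  continuous : Continuous N
  map_zero : N 0 = 0
  lipschitz : ∀ x y, ‖x‖ ≤ R → ‖y‖ ≤ R → ‖N x - N y‖ ≤ 1 / 4 * ‖x - y‖
  integrable : Integrable ρ (volume.restrict (Ioi 0))
  integral_le : ‖Q‖ * ∫ a in Ioi (0 : ℝ), ‖ρ a‖ ≤ P₁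
  bound : ∀ᵐ a ∂(volume.restrict (Ioi (0 : ℝ))), ‖Q‖ * ‖ρ a‖ ≤ P
  small : P * (h / ε) ≤ 1 / 4

namespace IsDelayProblem

variable {N : H → H} {Q : H →L[ℝ] H →L[ℝ] H} {ε : ℝ} {ρ : ℝ → H} {P₁ P h R : ℝ}

theorem mono (p : IsDelayProblem N Q ε ρ P₁ P h R) {R' : ℝ} (h0 : 0 ≤ R') (hR : R' ≤ R) :
    IsDelayProblem N Q ε ρ P₁ P h R' :=
  { p with R_nonneg := h0
           lipschitz := fun x y hx hy => p.lipschitz x y (hx.trans hR) (hy.trans hR) }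

theorem norm_delay_sub_le (p : IsDelayProblem N Q ε ρ P₁ P h R) {z z' : ℝ → H} {t τ σ K d : ℝ}
    (ht : t ≤ τ) (hth : t ≤ σ + h) (hd : 0 ≤ d)
    (hz : AEStronglyMeasurable z (volume.restrict (Iio τ)))
    (hz' : AEStronglyMeasurable z' (volume.restrict (Iio τ)))
    (hK : ∀ᵐ s ∂(volume.restrict (Iio τ)), ‖z s‖ ≤ K)
    (hK' : ∀ᵐ s ∂(volume.restrict (Iio τ)), ‖z' s‖ ≤ K)
    (he : ∀ᵐ s ∂(volume.restrict (Iio τ)), s < σ → z s = z' s)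
    (hzd : ∀ᵐ s ∂(volume.restrict (Iio τ)), ‖z s - z' s‖ ≤ d) :
    ‖delay Q ε ρ z t - delay Q ε ρ z' t‖ ≤ 1 / 4 * d :=
  (DelayedFilament.norm_delay_sub_le Q p.ε_pos p.integrable p.bound ht hth p.h_pos.le hd hz hz' hK
    hK' he hzd).trans (mul_le_mul_of_nonneg_right p.small hd)

/-- Uniqueness on one time step. -/
theorem unique_step (p : IsDelayProblem N Q ε ρ P₁ P h R) {z z' : ℝ → H} {σ τ : ℝ}
    (hτ : τ ≤ σ + h)
    (hz : AEStronglyMeasurable z (volume.restrict (Iio τ)))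
    (hz' : AEStronglyMeasurable z' (volume.restrict (Iio τ)))
    (hR : ∀ᵐ s ∂(volume.restrict (Iio τ)), ‖z s‖ ≤ R)
    (hR' : ∀ᵐ s ∂(volume.restrict (Iio τ)), ‖z' s‖ ≤ R)
    (he : ∀ᵐ s ∂(volume.restrict (Iio σ)), z s = z' s)
    (eq : ∀ᵐ t ∂(volume.restrict (Ioo σ τ)), z t = N (z t) + delay Q ε ρ z t)
    (eq' : ∀ᵐ t ∂(volume.restrict (Ioo σ τ)), z' t = N (z' t) + delay Q ε ρ z' t) :
    ∀ᵐ s ∂(volume.restrict (Iio τ)), z s = z' s := by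
  have hIoo : Ioo σ τ ⊆ Iio τ := fun _ hx => hx.2
  have he' : ∀ᵐ s ∂(volume.restrict (Iio τ)), s < σ → z s = z' s := by
    refine ae_restrict_of_ae ?_
    rwa [ae_restrict_iff' measurableSet_Iio] at he
  -- Each pass through the equation halves the bound: 1/4 comes from `N` and 1/4 from the memory.
  -- The start 2R is the diameter of the ball.
  have key : ∀ j : ℕ, ∀ᵐ s ∂(volume.restrict (Iio τ)), ‖z s - z' s‖ ≤ 2 * R * (1 / 2) ^ j := by
    intro j
    have hj : ∀ j : ℕ, 0 ≤ 2 * R * (1 / 2) ^ j := fun j => by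
      have := p.R_nonneg; positivity
    induction j with
    | zero =>
      filter_upwards [hR, hR'] with s h1 h2
      linarith [norm_sub_le (z s) (z' s)]
    | succ j ih =>
      apply ae_Iio_of_Iio_of_Ioo (σ := σ)
      · filter_upwards [he] with s hs
        rw [hs, sub_self, norm_zero]
        exact hj _
      · filter_upwards [eq, eq', ae_restrict_of_ae_restrict_of_subset hIoo hR,
          ae_restrict_of_ae_restrict_of_subset hIoo hR',
          ae_restrict_of_ae_restrict_of_subset hIoo ih, ae_restrict_mem measurableSet_Ioo]
          with t e1 e2 b1 b2 b3 ht
        have k1 := p.lipschitz _ _ b1 b2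
        have k2 := p.norm_delay_sub_le ht.2.le (ht.2.le.trans hτ) (hj j) hz hz' hR hR' he' ih
        have k3 : z t - z' t = N (z t) - N (z' t) + (delay Q ε ρ z t - delay Q ε ρ z' t) := by
          conv_lhs => rw [e1, e2]
          abel
        have k4 : ‖z t - z' t‖
            ≤ ‖N (z t) - N (z' t)‖ + ‖delay Q ε ρ z t - delay Q ε ρ z' t‖ := by
          conv_lhs => rw [k3]
          exact norm_add_le _ _
        rw [pow_succ]
        linarith
  filter_upwards [ae_all_iff.2 key] with s hs
  have hlim : Tendsto (fun j : ℕ => 2 * R * (1 / 2 : ℝ) ^ j) atTop (𝓝 (2 * R * 0)) :=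
    (tendsto_pow_atTop_nhds_zero_of_lt_one (by norm_num) (by norm_num)).const_mul _
  have := ge_of_tendsto' hlim hs
  rw [mul_zero] at this
  exact sub_eq_zero.1 (norm_le_zero_iff.1 this)

/-- Uniqueness on any time interval. -/
theorem unique (p : IsDelayProblem N Q ε ρ P₁ P h R) {z z' : ℝ → H} {τ : ℝ}
    (hz : AEStronglyMeasurable z (volume.restrict (Iio τ)))
    (hz' : AEStronglyMeasurable z' (volume.restrict (Iio τ)))
    (hR : ∀ᵐ s ∂(volume.restrict (Iio τ)), ‖z s‖ ≤ R)
    (hR' : ∀ᵐ s ∂(volume.restrict (Iio τ)), ‖z' s‖ ≤ R)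
    (he : ∀ᵐ s ∂(volume.restrict (Iio 0)), z s = z' s)
    (eq : ∀ᵐ t ∂(volume.restrict (Ioo 0 τ)), z t = N (z t) + delay Q ε ρ z t)
    (eq' : ∀ᵐ t ∂(volume.restrict (Ioo 0 τ)), z' t = N (z' t) + delay Q ε ρ z' t) :
    ∀ᵐ s ∂(volume.restrict (Iio τ)), z s = z' s := by
  have key : ∀ k : ℕ, ∀ᵐ s ∂(volume.restrict (Iio (min (k * h) τ))), z s = z' s := by
    intro k
    induction k with
    | zero => exact ae_Iio_mono (by simp) he
    | succ k ih =>
      rcases le_total τ (k * h) with hk | hk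
      · rw [min_eq_right hk] at ih
        exact ae_Iio_mono (min_le_right _ _) ih
      · rw [min_eq_left hk] at ih
        have hθ : min (((k + 1 : ℕ) : ℝ) * h) τ ≤ τ := min_le_right _ _
        have hsub : Ioo (k * h) (min (((k + 1 : ℕ) : ℝ) * h) τ) ⊆ Ioo 0 τ :=
          Ioo_subset_Ioo (mul_nonneg (Nat.cast_nonneg k) p.h_pos.le) hθ
        have hm : volume.restrict (Iio (min (((k + 1 : ℕ) : ℝ) * h) τ)) ≤ volume.restrict (Iio τ) :=
          Measure.restrict_mono (Iio_subset_Iio hθ) le_rfl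
        exact p.unique_step ((min_le_left _ _).trans_eq (by push_cast; ring)) (hz.mono_measure hm)
          (hz'.mono_measure hm) (ae_Iio_mono hθ hR) (ae_Iio_mono hθ hR') ih
          (ae_restrict_of_ae_restrict_of_subset hsub eq)
          (ae_restrict_of_ae_restrict_of_subset hsub eq')
  obtain ⟨k, hk⟩ := exists_nat_ge (τ / h)
  have := key k
  rwa [min_eq_right ((div_le_iff₀ p.h_pos).1 hk)] at this

/-- Continuation of a function over one time step by a solution of the delay equation. -/
theorem exists_extension [CompleteSpace H] (p : IsDelayProblem N Q ε ρ P₁ P h R) {y : ℝ → H}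
    (hy : StronglyMeasurable y) {σ τ K : ℝ} (hτ : τ = σ + h) (hK0 : 0 ≤ K)
    (hK : ∀ᵐ s ∂(volume.restrict (Iio σ)), ‖y s‖ ≤ K) (hKR : K ≤ R) (hPK : P₁ * K ≤ R / 2) :
    ∃ z : Lp H ∞ (volume.restrict (Iio τ)), ‖z‖ ≤ R ∧
      (∀ᵐ t ∂(volume.restrict (Iio σ)), z t = y t) ∧
      ∀ᵐ t ∂(volume.restrict (Ioo σ τ)), z t = N (z t) + delay Q ε ρ z t := by
  subst hτ
  set τ := σ + h with hτ
  have hστ : σ ≤ τ := by linarith [p.h_pos]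
  have hIoo : Ioo σ τ ⊆ Iio τ := fun _ hx => hx.2
  have hR0 := p.R_nonneg
  set E := Lp H ∞ (volume.restrict (Iio τ))
  -- The history is built into the map, not imposed on `z`. The contraction thus acts on a full
  -- closed ball of `E`, and its fixed point acquires the history automatically.
  let glue : E → ℝ → H := fun z t => if t < σ then y t else z t
  let φ : E → ℝ → H := fun z t => if t < σ then y t else N (z t) + delay Q ε ρ (glue z) t
  have hglue : ∀ z : E, StronglyMeasurable (glue z) := fun z =>
    StronglyMeasurable.ite measurableSet_Iio hy (Lp.stronglyMeasurable z)
  have hφ : ∀ z : E, StronglyMeasurable (φ z) := fun z =>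
    StronglyMeasurable.ite measurableSet_Iio hy
      ((p.continuous.comp_stronglyMeasurable (Lp.stronglyMeasurable z)).add
        (stronglyMeasurable_delay Q ε p.integrable.aestronglyMeasurable (hglue z)))
  have hyK : ∀ᵐ s ∂(volume.restrict (Iio τ)), s < σ → ‖y s‖ ≤ K := by
    refine ae_restrict_of_ae ?_
    rwa [ae_restrict_iff' measurableSet_Iio] at hK
  have hgR : ∀ z : E, ‖z‖ ≤ R → ∀ᵐ s ∂(volume.restrict (Iio τ)), ‖glue z s‖ ≤ R := by
    intro z hz
    filter_upwards [hyK, ae_norm_le_norm z] with s h1 h2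
    by_cases hs : s < σ
    · simp only [glue, if_pos hs]; exact (h1 hs).trans hKR
    · simp only [glue, if_neg hs]; exact h2.trans hz
  -- The history alone, cut off to zero after σ. It splits the bound on the image as R = R/4 + R/2 +
  -- R/4: nonlinearity, memory of the history, memory of the new piece.
  let y₀ : ℝ → H := fun t => if t < σ then y t else 0
  have hy₀ : StronglyMeasurable y₀ :=
    StronglyMeasurable.ite measurableSet_Iio hy stronglyMeasurable_const
  have hy₀K : ∀ᵐ s ∂(volume.restrict (Iio τ)), ‖y₀ s‖ ≤ K := by
    filter_upwards [hyK] with s h1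
    by_cases hs : s < σ
    · simp only [y₀, if_pos hs]; exact h1 hs
    · simp only [y₀, if_neg hs, norm_zero]; exact hK0
  have hφR : ∀ z : E, ‖z‖ ≤ R → ∀ᵐ t ∂(volume.restrict (Iio τ)), ‖φ z t‖ ≤ R := by
    intro z hz
    filter_upwards [hyK, ae_norm_le_norm z, ae_restrict_mem measurableSet_Iio] with t h1 h2 ht
    by_cases hs : t < σ
    · simp only [φ, if_pos hs]; exact (h1 hs).trans hKR
    · simp only [φ, if_neg hs]
      have k1 : ‖N (z t)‖ ≤ 1 / 4 * R := by
        have := p.lipschitz (z t) 0 (h2.trans hz) (by simpa using hR0)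
        rw [p.map_zero, sub_zero, sub_zero] at this
        linarith
      have k2 : ‖delay Q ε ρ y₀ t‖ ≤ R / 2 := by
        refine (norm_delay_le Q p.ε_pos p.integrable (le_of_lt ht) hy₀K).trans ?_
        refine le_trans ?_ hPK
        rw [mul_comm]
        exact mul_le_mul_of_nonneg_right p.integral_le hK0
      have k3 : ‖delay Q ε ρ (glue z) t - delay Q ε ρ y₀ t‖ ≤ 1 / 4 * R := by
        refine p.norm_delay_sub_le (σ := σ) (le_of_lt ht) (le_of_lt ht) hR0
          (hglue z).aestronglyMeasurable hy₀.aestronglyMeasurable (hgR z hz)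
          (hy₀K.mono fun s hs => hs.trans hKR) ?_ ?_
        · filter_upwards with s hs
          simp only [glue, y₀, if_pos hs]
        · filter_upwards [ae_norm_le_norm z] with s h3
          by_cases hs : s < σ
          · simp only [glue, y₀, if_pos hs, sub_self, norm_zero]; exact hR0
          · simp only [glue, y₀, if_neg hs, sub_zero]; exact h3.trans hz
      have k4 := norm_add_le (N (z t)) (delay Q ε ρ (glue z) t)
      have k5 := norm_le_insert' (delay Q ε ρ (glue z) t) (delay Q ε ρ y₀ t)
      linarith
  choose Ψ hΨ hΨR using fun z : Metric.closedBall (0 : E) R =>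
    exists_Lp_top (hφ z).aestronglyMeasurable hR0 (hφR z (mem_closedBall_zero_iff.1 z.2))
  let Φ : Metric.closedBall (0 : E) R → Metric.closedBall (0 : E) R :=
    fun z => ⟨Ψ z, mem_closedBall_zero_iff.2 (hΨR z)⟩
  have hcontr : ContractingWith (1 / 2) Φ := by
    refine ⟨by norm_num, LipschitzWith.of_dist_le_mul fun z z' => ?_⟩
    rw [Subtype.dist_eq, Subtype.dist_eq, dist_eq_norm, dist_eq_norm]
    have hz := mem_closedBall_zero_iff.1 z.2
    have hz' := mem_closedBall_zero_iff.1 z'.2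
    set d := ‖(z : E) - (z' : E)‖
    have hd : 0 ≤ d := norm_nonneg _
    have hzd : ∀ᵐ s ∂(volume.restrict (Iio τ)), ‖(z : E) s - (z' : E) s‖ ≤ d := by
      filter_upwards [ae_norm_le_norm ((z : E) - (z' : E)), Lp.coeFn_sub (z : E) (z' : E)]
        with s h1 h2
      rwa [h2] at h1
    have hhalf : (((1 / 2 : ℝ≥0)) : ℝ) = 1 / 2 := by norm_num
    rw [hhalf]
    apply norm_le_of_ae_norm_le (by positivity)
    filter_upwards [hΨ z, hΨ z', Lp.coeFn_sub (Ψ z) (Ψ z'), hzd, ae_norm_le_norm (z : E),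
      ae_norm_le_norm (z' : E), ae_restrict_mem measurableSet_Iio] with t h1 h2 h3 h4 h5 h6 ht
    change ‖(Ψ z - Ψ z') t‖ ≤ 1 / 2 * d
    rw [h3, Pi.sub_apply, h1, h2]
    by_cases hs : t < σ
    · simp only [φ, if_pos hs, sub_self, norm_zero]; positivity
    · simp only [φ, if_neg hs]
      have k1 := p.lipschitz _ _ (h5.trans hz) (h6.trans hz')
      have k2 : ‖delay Q ε ρ (glue z) t - delay Q ε ρ (glue z') t‖ ≤ 1 / 4 * d := by
        refine p.norm_delay_sub_le (σ := σ) (le_of_lt ht) (le_of_lt ht) hd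
          (hglue z).aestronglyMeasurable (hglue z').aestronglyMeasurable (hgR z hz) (hgR z' hz')
          ?_ ?_
        · filter_upwards with s hs
          simp only [glue, if_pos hs]
        · filter_upwards [hzd] with s h3
          by_cases hs : s < σ
          · simp only [glue, if_pos hs, sub_self, norm_zero]; exact hd
          · simp only [glue, if_neg hs]; exact h3
      have k3 : N ((z : E) t) + delay Q ε ρ (glue z) t - (N ((z' : E) t) + delay Q ε ρ (glue z') t)
          = (N ((z : E) t) - N ((z' : E) t))
            + (delay Q ε ρ (glue z) t - delay Q ε ρ (glue z') t) := by abel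
      rw [k3]
      have := norm_add_le (N ((z : E) t) - N ((z' : E) t))
        (delay Q ε ρ (glue z) t - delay Q ε ρ (glue z') t)
      linarith
  have : CompleteSpace (Metric.closedBall (0 : E) R) :=
    Metric.isClosed_closedBall.completeSpace_coe
  have : Nonempty (Metric.closedBall (0 : E) R) := ⟨⟨0, Metric.mem_closedBall_self hR0⟩⟩
  set z := ContractingWith.fixedPoint Φ hcontr
  have hfix : Φ z = z := hcontr.fixedPoint_isFixedPt
  have hzφ : ∀ᵐ t ∂(volume.restrict (Iio τ)), (z : E) t = φ z t := by
    have h1 : Ψ z = (z : E) := congrArg Subtype.val hfix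
    have h2 := hΨ z
    rwa [h1] at h2
  have hzy : ∀ᵐ t ∂(volume.restrict (Iio σ)), (z : E) t = y t := by
    filter_upwards [ae_Iio_mono hστ hzφ, ae_restrict_mem measurableSet_Iio] with t h1 ht
    rw [h1]
    exact if_pos ht
  refine ⟨z, mem_closedBall_zero_iff.1 z.2, hzy, ?_⟩
  -- A fixed point agrees with its own glued version, so the equation it satisfies is the original
  -- one.
  have hgz : ∀ᵐ s ∂(volume.restrict (Iio τ)), glue z s = (z : E) s := by
    apply ae_Iio_of_Iio_of_Ioo (σ := σ)
    · filter_upwards [hzy, ae_restrict_mem measurableSet_Iio] with s h1 hs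
      rw [h1]
      exact if_pos hs
    · filter_upwards [ae_restrict_mem measurableSet_Ioo] with s hs
      exact if_neg (not_lt.2 hs.1.le)
  filter_upwards [ae_restrict_of_ae_restrict_of_subset hIoo hzφ, ae_restrict_mem measurableSet_Ioo]
    with t h1 ht
  rw [← delay_congr p.ε_pos ht.2.le hgz]
  conv_lhs => rw [h1]
  exact if_neg (not_lt.2 ht.1.le)

end IsDelayProblem

end Delay

/-! ### Solutions on varying intervals and the maximal time. -/

section Delay

variable {H : Type*} [NormedAddCommGroup H] [NormedSpace ℝ H]

/-- `z` solves the abstract delay equation on `(0, τ)` with past data `y`. -/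
structure IsDelaySolution (N : H → H) (Q : H →L[ℝ] H →L[ℝ] H) (ε : ℝ) (ρ y : ℝ → H) (τ : ℝ)
    (z : ℝ → H) : Prop where
  eqn : ∀ᵐ t ∂(volume.restrict (Ioo 0 τ)), z t = N (z t) + delay Q ε ρ z t
  past : ∀ᵐ t ∂(volume.restrict (Iio (0 : ℝ))), z t = y t

variable {N : H → H} {Q : H →L[ℝ] H →L[ℝ] H} {ε : ℝ} {ρ y : ℝ → H} {P₁ P h R : ℝ}

theorem IsDelaySolution.mono {σ τ : ℝ} {z : ℝ → H} (hz : IsDelaySolution N Q ε ρ y τ z)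
    (h : σ ≤ τ) : IsDelaySolution N Q ε ρ y σ z where
  eqn := ae_restrict_of_ae_restrict_of_subset (Ioo_subset_Ioo_right h) hz.eqn
  past := hz.past

/-- The equation at time t sees only values of z before t and at t, so it survives a change of z on
a null set. -/
theorem ae_eqn_congr (hε : 0 < ε) {σ τ : ℝ} {z w : ℝ → H}
    (h : ∀ᵐ t ∂(volume.restrict (Iio τ)), z t = w t)
    (hw : ∀ᵐ t ∂(volume.restrict (Ioo σ τ)), w t = N (w t) + delay Q ε ρ w t) :
    ∀ᵐ t ∂(volume.restrict (Ioo σ τ)), z t = N (z t) + delay Q ε ρ z t := by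
  have hs : Ioo σ τ ⊆ Iio τ := fun _ hx => hx.2
  filter_upwards [hw, ae_restrict_of_ae_restrict_of_subset hs h, ae_restrict_mem measurableSet_Ioo]
    with t h1 h2 ht
  rw [delay_congr hε ht.2.le h, h2]
  exact h1

theorem IsDelayProblem.unique_Lp (p : IsDelayProblem N Q ε ρ P₁ P h R) {σ τ : ℝ} (hστ : σ ≤ τ)
    {z : Lp H ∞ (volume.restrict (Iio σ))} {w : Lp H ∞ (volume.restrict (Iio τ))}
    (hz : IsDelaySolution N Q ε ρ y σ z) (hw : IsDelaySolution N Q ε ρ y τ w)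
    (hzR : ‖z‖ ≤ R) (hwR : ‖w‖ ≤ R) : ∀ᵐ t ∂(volume.restrict (Iio σ)), z t = w t := by
  refine p.unique (Lp.aestronglyMeasurable z) (Lp.stronglyMeasurable w).aestronglyMeasurable
    ?_ ?_ ?_ hz.eqn (hw.mono hστ).eqn
  · filter_upwards [ae_norm_le_norm z] with t ht using ht.trans hzR
  · filter_upwards [ae_Iio_mono hστ (ae_norm_le_norm w)] with t ht using ht.trans hwR
  · filter_upwards [hz.past, hw.past] with t h1 h2
    rw [h1, h2]

/-- The maximal solution, and the alternative at the maximal time. -/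
theorem IsDelayProblem.exists_maximal [CompleteSpace H] (p : IsDelayProblem N Q ε ρ P₁ P h R)
    {z : Lp H ∞ (volume.restrict (Iio h))} (hz : IsDelaySolution N Q ε ρ y h z) (hzR : ‖z‖ ≤ R)
    {κ : ℝ} (hκ : ∀ K, 0 ≤ K → K < κ → K ≤ R ∧ P₁ * K ≤ R / 2) {S : Set ℝ}
    (hS : ∀ τ, τ ∈ S ↔ 0 < τ ∧ ∃ w : Lp H ∞ (volume.restrict (Iio τ)),
      IsDelaySolution N Q ε ρ y τ w ∧ (∀ᵐ t ∂(volume.restrict (Iio (min h τ))), w t = z t) ∧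
        ‖w‖ ≤ R) {T : ℝ} (hT : IsLUB S T) :
    ∃ Z : Lp H ∞ (volume.restrict (Iio T)), IsDelaySolution N Q ε ρ y T Z ∧
      (∀ᵐ t ∂(volume.restrict (Iio (min h T))), Z t = z t) ∧ ‖Z‖ ≤ R ∧ κ ≤ ‖Z‖ := by
  have hhS : h ∈ S := (hS h).2 ⟨p.h_pos, z, hz, by filter_upwards with t using rfl, hzR⟩
  obtain ⟨τ, -, hτT, hτ, hτS⟩ := hT.exists_seq_monotone_tendsto ⟨h, hhS⟩
  have hτ0 : ∀ n, 0 < τ n := fun n => ((hS _).1 (hτS n)).1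
  choose W hW hWz hWR using fun n => ((hS _).1 (hτS n)).2
  have hT0 : 0 < T := (hτ0 0).trans_le (hτT 0)
  -- Uniqueness in the ball of radius R makes the solutions along a sequence of times tending to T
  -- compatible.
  obtain ⟨Z, hZR, hZW⟩ := exists_glued hτT hτ p.R_nonneg W hWR (by
    intro n m
    rcases le_total (τ n) (τ m) with hnm | hnm
    · rw [min_eq_left hnm]
      exact p.unique_Lp hnm (hW n) (hW m) (hWR n) (hWR m)
    · rw [min_eq_right hnm]
      filter_upwards [p.unique_Lp hnm (hW m) (hW n) (hWR m) (hWR n)] with t ht using ht.symm)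
  have lift : ∀ {A : ℝ → Prop} (b : ℝ), (∀ n, ∀ᵐ t ∂(volume.restrict (Ioo b (τ n))), A t) →
      ∀ᵐ t ∂(volume.restrict (Ioo b T)), A t := by
    intro A b hA
    have h1 : ∀ᵐ t, ∀ n, t ∈ Ioo b (τ n) → A t := by
      rw [ae_all_iff]; intro n
      have := hA n
      rwa [ae_restrict_iff' measurableSet_Ioo] at this
    rw [ae_restrict_iff' measurableSet_Ioo]
    filter_upwards [h1] with t h2 ht
    obtain ⟨n, hn⟩ := (hτ.eventually_const_lt ht.2).exists
    exact h2 n ⟨ht.1, hn⟩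
  have hZsol : IsDelaySolution N Q ε ρ y T Z := by
    refine ⟨lift 0 fun n => ae_eqn_congr p.ε_pos (hZW n) (hW n).eqn, ?_⟩
    filter_upwards [ae_Iio_mono (hτ0 0).le (hZW 0), (hW 0).past] with t h1 h2
    rw [h1, h2]
  have hhT : h ≤ T := hT.1 hhS
  have hZz : ∀ᵐ t ∂(volume.restrict (Iio (min h T))), Z t = z t := by
    rw [min_eq_left hhT]
    filter_upwards [p.unique_Lp hhT hz hZsol hzR hZR] with t ht using ht.symm
  refine ⟨Z, hZsol, hZz, hZR, ?_⟩
  -- If the norm were below κ, the whole of `Z` would be an admissible history for one more step,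
  -- and T + h would belong to `S`.
  by_contra! hlt
  obtain ⟨k1, k2⟩ := hκ _ (norm_nonneg _) hlt
  obtain ⟨w, hwR, hwZ, hweq⟩ := p.exists_extension (Lp.stronglyMeasurable Z) (σ := T) rfl
    (norm_nonneg Z) (ae_norm_le_norm Z) k1 k2
  have hmem : T + h ∈ S := by
    refine (hS _).2 ⟨add_pos hT0 p.h_pos, w, ⟨?_, ?_⟩, ?_, hwR⟩
    · have h1 := ae_eqn_congr p.ε_pos hwZ hZsol.eqn
      rw [ae_restrict_iff' measurableSet_Ioo] at h1 hweq ⊢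
      filter_upwards [h1, hweq, Measure.ae_ne volume T] with t e1 e2 e3 ht
      rcases lt_or_gt_of_ne e3 with hc | hc
      · exact e1 ⟨ht.1, hc⟩
      · exact e2 ⟨hc, ht.2⟩
    · filter_upwards [ae_Iio_mono hT0.le hwZ, hZsol.past] with t h1 h2
      rw [h1, h2]
    · rw [min_eq_left (by linarith)]
      rw [min_eq_left hhT] at hZz
      filter_upwards [ae_Iio_mono hhT hwZ, hZz] with t h1 h2
      rw [h1, h2]
  have := hT.1 hmem
  linarith [p.h_pos]

end Delay

/-! ### The memory term in `H²` -/

/-- The memory integral is defined in L¹, while the argument needs it in H². The embedding of H²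
into L¹ is bounded and so commutes with the Bochner integral of the products formed in the algebra
`H2`. -/
theorem memory_ae_eq {L : ℝ} {M : H2 L →L[ℝ] H2 L →L[ℝ] H2 L}
    (hM : ∀ u v, D 0 (M u v) =ᵐ[volI L] (fun s => D 0 u s * D 0 v s)) {ε : ℝ} {ρ z : ℝ → H2 L}
    {t : ℝ} (hi : Integrable (fun a => M (z (t - ε * a)) (ρ a)) (volume.restrict (Ioi (0 : ℝ)))) :
    memory ε ρ z t =ᵐ[volI L] D 0 (delay M ε ρ z t) := by
  have h1 : MemLp (fun _ : ℝ => (1 : ℝ)) 2 (volI L) := memLp_const 1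
  -- The inclusion of L² into L¹, written as the Hölder product with the constant 1.
  let ι : L2 L →L[ℝ] Lp ℝ 1 (volI L) :=
    (ContinuousLinearMap.mul ℝ ℝ).holderL (volI L) 2 2 1 (h1.toLp _)
  have hι : ∀ f : L2 L, ι f =ᵐ[volI L] f := by
    intro f
    have h2 := (ContinuousLinearMap.mul ℝ ℝ).coeFn_holder (r := 1) (h1.toLp _) f
    filter_upwards [h2, h1.coeFn_toLp] with s e1 e2
    change (ContinuousLinearMap.mul ℝ ℝ).holder 1 (h1.toLp _) f s = f s
    rw [e1, e2]
    simp
  have h2 : memory ε ρ z t = ι (D 0 (delay M ε ρ z t)) := by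
    have h3 := (ι.comp (DL 0)).integral_comp_comm hi
    change _ = ι (D 0 (delay M ε ρ z t)) at h3
    rw [← h3, memory]
    congr 1
    ext1 a
    apply Lp.ext
    filter_upwards [Lp.coeFn_lpSMul (r := 1) (D 0 (z (t - ε * a))) (D 0 (ρ a)), hM (z (t - ε * a)) (ρ a),
      hι (D 0 (M (z (t - ε * a)) (ρ a)))] with s e1 e2 e3
    change _ = ι (D 0 (M (z (t - ε * a)) (ρ a))) s
    rw [e1, e3, e2]
    simp
  rw [h2]
  exact hι _

theorem mu_eq {L : ℝ} {ρ : ℝ → H2 L} (hi : Integrable ρ (volume.restrict (Ioi (0 : ℝ)))) :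
    mu ρ = D 0 (∫ a in Ioi (0 : ℝ), ρ a) :=
  (DL 0).integral_comp_comm hi

/-- Continuity on the whole space supplies the measurability of t ↦ N (z t) in the contraction
argument. -/
theorem continuous_of_lipschitz_on_balls {E : Type*} [NormedAddCommGroup E] {f : E → E} {C : ℝ}
    (hf : ∀ (R : ℝ) (x y : E), ‖x‖ ≤ R → ‖y‖ ≤ R → ‖f x - f y‖ ≤ C * (1 + R ^ 2) * ‖x - y‖) :
    Continuous f := by
  rw [continuous_iff_continuousAt]
  intro x
  rw [ContinuousAt, tendsto_iff_norm_sub_tendsto_zero]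
  have h1 : Tendsto (fun y => C * (1 + (‖x‖ + 1) ^ 2) * ‖y - x‖) (𝓝 x) (𝓝 0) := by
    have h2 : Tendsto (fun y => ‖y - x‖) (𝓝 x) (𝓝 0) :=
      tendsto_iff_norm_sub_tendsto_zero.1 tendsto_id
    simpa using h2.const_mul (C * (1 + (‖x‖ + 1) ^ 2))
  refine squeeze_zero' (Eventually.of_forall fun _ => norm_nonneg _) ?_ h1
  filter_upwards [Metric.ball_mem_nhds x one_pos] with y hy
  refine hf _ y x ?_ (by linarith)
  have := norm_le_insert' y x
  rw [Metric.mem_ball, dist_eq_norm] at hy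
  linarith

/-- The delayed problem in `H²`, as an abstract delay equation. -/
theorem exists_delay_formulation {L : ℝ} (hL : 0 < L) {ρ : ℝ → H2 L} (hρ : IsKernel ρ) :
    ∃ CN P₁ P : ℝ, 1 ≤ CN ∧ 0 ≤ P₁ ∧ 0 ≤ P ∧ ∀ ε : ℝ, 0 < ε → ε ≤ 1 →
      ∃ (N : H2 L → H2 L) (Q : H2 L →L[ℝ] H2 L →L[ℝ] H2 L),
        (∀ R h : ℝ, 0 ≤ R → 0 < h → P * (h / ε) ≤ 1 / 4 →
          CN * ε ^ (1 / 4 : ℝ) * (1 + R ^ 2) ≤ 1 / 4 → IsDelayProblem N Q ε ρ P₁ P h R) ∧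
        ∀ (zp : X L 0) (τ : ℝ) (z : X L τ),
          IsSolution ε ρ zp τ z ↔ IsDelaySolution N Q ε ρ zp τ z := by
  have hi : Integrable ρ (volume.restrict (Ioi (0 : ℝ))) := memLp_one_iff_integrable.1 hρ.memLp_one
  obtain ⟨c, hc, hm⟩ := hρ.mu_pos
  set m := ∫ a in Ioi (0 : ℝ), ρ a
  have hmu : mu ρ = D 0 m := mu_eq hi
  rw [hmu] at hm
  obtain ⟨M, hM⟩ := exists_mulL hL
  obtain ⟨CN, hCN1, hCN⟩ := exists_nonlin_lipschitz hL hc hm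
  obtain ⟨CB, hCB0, hCB⟩ := exists_A₂L hL hc hm
  obtain ⟨r, hr0, hr⟩ : ∃ r : ℝ, 0 ≤ r ∧ ∀ᵐ a ∂(volume.restrict (Ioi (0 : ℝ))), ‖ρ a‖ ≤ r := by
    exact exists_ae_norm_le hρ.memLp_top
  have hint0 : 0 ≤ ∫ a in Ioi (0 : ℝ), ‖ρ a‖ := integral_nonneg fun _ => norm_nonneg _
  refine ⟨CN, CB * ‖M‖ * ∫ a in Ioi (0 : ℝ), ‖ρ a‖, CB * ‖M‖ * r, hCN1, by positivity,
    by positivity, fun ε hε hε1 => ?_⟩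
  obtain ⟨B, hB, hBA⟩ := hCB ε hε hε1
  obtain ⟨hN0, hN⟩ := hCN ε hε hε1
  -- A₂ is absorbed into the bilinear map, since a bounded operator can be moved inside the memory
  -- integral.
  let Q : H2 L →L[ℝ] H2 L →L[ℝ] H2 L := (ContinuousLinearMap.compL ℝ (H2 L) (H2 L) (H2 L) B).comp M
  have hQ : ‖Q‖ ≤ CB * ‖M‖ := by
    refine ContinuousLinearMap.opNorm_le_bound₂ _ (by positivity) fun x y => ?_
    calc ‖B (M x y)‖ ≤ CB * (‖M‖ * ‖x‖ * ‖y‖) :=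
          (B.le_of_opNorm_le hB _).trans (mul_le_mul_of_nonneg_left (M.le_opNorm₂ x y) hCB0)
      _ = _ := by ring
  refine ⟨nonlin L ε (D 0 m), Q, ?_, ?_⟩
  · intro R h hR hh hP hCR
    refine ⟨hε, hh, hR, ?_, hN0, ?_, hi, ?_, ?_, hP⟩
    · exact continuous_of_lipschitz_on_balls hN
    · intro x y hx hy
      exact (hN R x y hx hy).trans (mul_le_mul_of_nonneg_right hCR (norm_nonneg _))
    · exact mul_le_mul_of_nonneg_right hQ hint0
    · filter_upwards [hr] with a ha
      exact mul_le_mul hQ ha (norm_nonneg _) (by positivity)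
  · intro zp τ z
    have key : ∀ t, t < τ → A₂ L ε (mu ρ) (memory ε ρ z t) = delay Q ε ρ z t := by
      intro t ht
      have h1 := integrable_delay M hε hi ht.le (Lp.aestronglyMeasurable z) (ae_norm_le_norm z)
      rw [hmu, hBA _ _ (memory_ae_eq hM h1)]
      exact (B.integral_comp_comm h1).symm
    have hiff : (∀ᵐ t ∂(volume.restrict (Ioo 0 τ)),
        z t = A₁ L ε (mu ρ) (fun s => deriv F (D 1 (z t) s)) + A₂ L ε (mu ρ) (memory ε ρ z t)) ↔
        ∀ᵐ t ∂(volume.restrict (Ioo 0 τ)), z t = nonlin L ε (D 0 m) (z t) + delay Q ε ρ z t := by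
      apply eventually_congr
      filter_upwards [ae_restrict_mem measurableSet_Ioo] with t ht
      rw [key t ht.2, hmu, nonlin]
    exact ⟨fun h => ⟨hiff.1 h.eqn, h.past⟩, fun h => ⟨hiff.2 h.eqn, h.past⟩⟩

/-! ### Powers of ε, the choice of constants and the theorem. -/

/-- If `ε ≤ (c / r)⁸` with `r ≥ 1`, then `ε^(1/4) ≤ c²` and `r ≤ c ε^(-1/8)`. -/
theorem scaling {ε c r : ℝ} (hε : 0 < ε) (hc : 0 < c) (hr : 1 ≤ r)
    (h : ε ≤ c ^ 8 * r ^ (-8 : ℤ)) :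
    ε ^ (1 / 4 : ℝ) ≤ c ^ 2 ∧ r ≤ c * ε ^ (-(1 / 8) : ℝ) ∧
      ε ^ (1 / 4 : ℝ) * (c * ε ^ (-(1 / 8) : ℝ)) ^ 2 = c ^ 2 := by
  set e := ε ^ (1 / 8 : ℝ) with he
  have he0 : 0 < e := Real.rpow_pos_of_pos hε _
  have he8 : e ^ 8 = ε := by
    rw [he, ← Real.rpow_natCast, ← Real.rpow_mul hε.le]; norm_num
  have he2 : ε ^ (1 / 4 : ℝ) = e ^ 2 := by
    rw [he, ← Real.rpow_natCast, ← Real.rpow_mul hε.le]; norm_num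
  have hei : ε ^ (-(1 / 8) : ℝ) = e⁻¹ := by rw [he, Real.rpow_neg hε.le]
  have hr0 : 0 < r := by linarith
  have h1 : e ^ 8 ≤ (c / r) ^ 8 := by
    rw [he8, div_pow]
    refine h.trans_eq ?_
    rw [zpow_neg, div_eq_mul_inv]
    norm_cast
  have h2 : e ≤ c / r := le_of_pow_le_pow_left₀ (by norm_num) (by positivity) h1
  have h3 : e * r ≤ c := (le_div_iff₀ hr0).1 h2
  have h4 : e ≤ c := (le_mul_of_one_le_right he0.le hr).trans h3
  rw [he2, hei]
  refine ⟨by gcongr, ?_, by field_simp⟩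
  rw [← div_eq_mul_inv, le_div_iff₀ he0, mul_comm]
  exact h3

end DelayedFilament

end

theorem theorem4p1 (L : ℝ) (hL : 0 < L) (ρ : ℝ → DelayedFilament.H2 L)
    (hρ : DelayedFilament.IsKernel ρ) :
    ∃ c₁ c₂ c₃ c₄ c₅ : ℝ, 0 < c₁ ∧ 0 < c₂ ∧ c₂ < 1 ∧ 0 < c₃ ∧ 0 < c₄ ∧ 0 < c₅ ∧
      ∀ (zp : DelayedFilament.X L 0) (R₀ : ℝ), R₀ = 1 + c₁ * ‖zp‖ →
      ∀ ε : ℝ, 0 < ε → ε ≤ c₂ * R₀ ^ (-8 : ℤ) →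
        -- local existence, and uniqueness in the ball of radius `R₀`
        (∃! z : DelayedFilament.X L (c₃ * ε),
          DelayedFilament.IsSolution ε ρ zp (c₃ * ε) z ∧ ‖z‖ ≤ R₀) ∧
        -- uniqueness on any time interval, in the ball of radius `c₄ ε^(-1/8)`
        (∀ τ : ℝ, 0 < τ → ∀ z₁ z₂ : DelayedFilament.X L τ,
          DelayedFilament.IsSolution ε ρ zp τ z₁ → DelayedFilament.IsSolution ε ρ zp τ z₂ →
          ‖z₁‖ ≤ c₄ * ε ^ (-(1 / 8) : ℝ) → ‖z₂‖ ≤ c₄ * ε ^ (-(1 / 8) : ℝ) → z₁ = z₂) ∧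
        -- the maximal time `T` and, if it is finite, the maximal solution `Z`
        (∀ z : DelayedFilament.X L (c₃ * ε),
          DelayedFilament.IsSolution ε ρ zp (c₃ * ε) z → ‖z‖ ≤ R₀ →
          c₃ * ε ∈ DelayedFilament.extensionTimes ε ρ zp (c₄ * ε ^ (-(1 / 8) : ℝ)) z ∧
          ∀ T : ℝ,
            IsLUB (DelayedFilament.extensionTimes ε ρ zp (c₄ * ε ^ (-(1 / 8) : ℝ)) z) T →
            ∃ Z : DelayedFilament.X L T,
              DelayedFilament.IsSolution ε ρ zp T Z ∧ DelayedFilament.Agree z Z ∧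
              ‖Z‖ ≤ c₄ * ε ^ (-(1 / 8) : ℝ) ∧ c₅ * ε ^ (-(1 / 8) : ℝ) ≤ ‖Z‖) := by
  obtain ⟨CN, P₁, P, hCN, hP₁, hP, hform⟩ := DelayedFilament.exists_delay_formulation hL hρ
  have hCN0 : 0 < CN := by linarith
  have hQ : 0 < 1 / (8 * CN) := by positivity
  -- With R = c₄ ε^(-1/8), both ε^(1/4) and ε^(1/4) R² are at most c₄², so the Lipschitz constant of
  -- the nonlinearity is at most 2 CN c₄² = 1/4.
  set c₄ := Real.sqrt (1 / (8 * CN)) with hc₄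
  have hc₄0 : 0 < c₄ := Real.sqrt_pos.2 hQ
  have hc₄2 : c₄ ^ 2 = 1 / (8 * CN) := Real.sq_sqrt hQ.le
  have hc₄1 : c₄ < 1 := by
    rw [hc₄, Real.sqrt_lt' one_pos, div_lt_iff₀ (by positivity)]
    linarith
  have hc₃0 : 0 < 1 / (4 * (P + 1)) := by positivity
  -- Makes P c₃ ≤ 1/4; the added 1 keeps the denominator positive when P = 0.
  set c₃ := 1 / (4 * (P + 1)) with hc₃
  -- The factor 2P₁ + 1 gives both K ≤ R and P₁ K ≤ R/2 once (2P₁ + 1) K ≤ R. It is used for the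
  -- past data with radius R₀, and for the maximal solution with radius R. The choice c₂ = c₄⁸ is
  -- equivalent to R₀ ≤ c₄ ε^(-1/8) on the allowed range of ε.
  refine ⟨2 * P₁ + 1, c₄ ^ 8, c₃, c₄, c₄ / (2 * P₁ + 1), by positivity, by positivity,
    pow_lt_one₀ hc₄0.le hc₄1 (by norm_num), hc₃0, hc₄0, by positivity, ?_⟩
  intro zp R₀ hR₀ ε hε hεR
  have hzp : 0 ≤ ‖zp‖ := ENNReal.toReal_nonneg
  have hR₀1 : 1 ≤ R₀ := by
    rw [hR₀]
    have : 0 ≤ (2 * P₁ + 1) * ‖zp‖ := by positivity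
    linarith
  obtain ⟨hs1, hs2, hs3⟩ := DelayedFilament.scaling hε hc₄0 hR₀1 hεR
  have hε1 : ε ≤ 1 := by
    refine hεR.trans (mul_le_one₀ (pow_le_one₀ hc₄0.le hc₄1.le) (by positivity) ?_)
    exact zpow_le_one_of_nonpos₀ hR₀1 (by norm_num)
  set R := c₄ * ε ^ (-(1 / 8) : ℝ) with hR
  have hR0 : 0 ≤ R := by linarith
  obtain ⟨N, Q, hprob, hsol⟩ := hform ε hε hε1
  have hsmall : P * (c₃ * ε / ε) ≤ 1 / 4 := by
    rw [mul_div_assoc, div_self hε.ne', mul_one, hc₃, mul_one_div, div_le_iff₀ (by positivity)]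
    linarith
  have hlip : CN * ε ^ (1 / 4 : ℝ) * (1 + R ^ 2) ≤ 1 / 4 := by
    calc CN * ε ^ (1 / 4 : ℝ) * (1 + R ^ 2)
        = CN * (ε ^ (1 / 4 : ℝ) + ε ^ (1 / 4 : ℝ) * R ^ 2) := by ring
      _ ≤ CN * (c₄ ^ 2 + c₄ ^ 2) := by rw [hs3]; gcongr
      _ = 1 / 4 := by rw [hc₄2]; field_simp; norm_num
  have p := hprob R (c₃ * ε) hR0 (mul_pos hc₃0 hε) hsmall hlip
  have huniq : ∀ τ : ℝ, ∀ z₁ z₂ : DelayedFilament.X L τ,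
      DelayedFilament.IsSolution ε ρ zp τ z₁ → DelayedFilament.IsSolution ε ρ zp τ z₂ →
      ‖z₁‖ ≤ R → ‖z₂‖ ≤ R → z₁ = z₂ := fun τ z₁ z₂ h₁ h₂ n₁ n₂ =>
    Lp.ext (p.unique_Lp le_rfl ((hsol _ _ _).1 h₁) ((hsol _ _ _).1 h₂) n₁ n₂)
  refine ⟨?_, fun τ _ => huniq τ, ?_⟩
  -- Existence comes from the contraction in the smaller ball of radius R₀; uniqueness is inherited
  -- from the larger one.
  · obtain ⟨z, hz1, hz2, hz3⟩ := (p.mono (by linarith) hs2).exists_extension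
      (Lp.stronglyMeasurable zp) (zero_add _).symm hzp (DelayedFilament.ae_norm_le_norm zp)
      (by rw [hR₀]; nlinarith) (by rw [hR₀]; nlinarith)
    refine ⟨z, ⟨(hsol _ _ _).2 ⟨hz3, hz2⟩, hz1⟩, fun w hw => ?_⟩
    exact huniq _ w z hw.1 ((hsol _ _ _).2 ⟨hz3, hz2⟩) (hw.2.trans hs2) (hz1.trans hs2)
  · intro z hz hzR
    refine ⟨⟨mul_pos hc₃0 hε, z, hz, Filter.Eventually.of_forall fun _ => rfl, hzR.trans hs2⟩, ?_⟩
    intro T hT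
    obtain ⟨Z, h1, h2, h3, h4⟩ := p.exists_maximal ((hsol _ _ _).1 hz) (hzR.trans hs2)
      (κ := c₄ / (2 * P₁ + 1) * ε ^ (-(1 / 8) : ℝ)) (by
        intro K hK0 hK
        have hk : K * (2 * P₁ + 1) < R := by
          rw [div_mul_eq_mul_div, ← hR, lt_div_iff₀ (by positivity)] at hK
          exact hK
        have := mul_nonneg hK0 hP₁
        constructor <;> linarith)
      (S := DelayedFilament.extensionTimes ε ρ zp R z) (by
        intro τ
        simp only [← hsol]
        exact Iff.rfl) hT
    exact ⟨Z, (hsol _ _ _).2 h1, h2, h3, h4⟩
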